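/- Let $H$ be a binary $m\times n$ matrix, regarded as the parity-check matrix of a code of length $n$. Its Tanner graph is the bipartite graph whose variable nodes are the columns of $H$ and whose check nodes are the rows of $H$, with variable node $j$ and check node $r$ adjacent iff $H_{r,j}=1$. For constants $\delta_v,\delta_c>2$, the matrix $H$ is called $(\delta_v,\delta_c)$-LDPC if every variable node has degree at most $\delta_v$ and every check node has degree at most $\delta_c$. A cover stopping set of $H$ is a set $S$ of variable nodes such that every check node has at least two neighbours in $S$. Let $\kappa=\kappa(H)$ be the minimum cardinality of a cover stopping set, with $\kappa=0$ if there is none. The problem MinCStop asks, given $H$ (by $n$, $m$ and, for each check node, its degree and the list of its neighbours), to find a cover stopping set of cardinality $\kappa$, or to report that there is none. Theorem. Let $\delta_v,\delta_c>2$ be fixed integers. Then MinCStop, restricted to $(\delta_v,\delta_c)$-LDPC matrices, is fixed-parameter tractable in the parameter $\kappa$: there are an algorithm, a computable function $f:\mathbb{N}\to\mathbb{N}$ and a constant $c$ such that the algorithm solves every instance in at most $f(\kappa)\,(N+1)^c$ steps, where $N$ is the number of nodes and edges of the Tanner graph. Moreover, there are an algorithm that solves the problem and a constant $C$ depending only on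 $\delta_v$ and $\delta_c$, such that on every instance the number of steps is at most $C(\beta^{\kappa}+n)$, where $$\beta=\frac{\delta_c-2}{2}\left(1+\sqrt{1+\frac{4}{(\delta_c-2)^2}}\right).$$ Here algorithms are programs of a unit-cost random access machine over the natural numbers with addition and truncated subtraction, conditionals and loops. -/

import Mathlib

namespace Tanner

/-! ### Tanner graphs and cover stopping sets

A binary matrix `H` with `m` rows and `n` columns is read as a parity-check matrix. Its Tanner graph
has the columns as variable nodes, the rows as check nodes, and an edge `(j, r)` iff `H r j = 1`. -/

/-- Neighbours of the check node `r`, in increasing order. -/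
def checkList {m n : ℕ} (H : Matrix (Fin m) (Fin n) (ZMod 2)) (r : Fin m) : List (Fin n) :=
  (List.finRange n).filter fun j => H r j = 1

/-- Neighbours of the check node `r`. -/
def checkNbrs {m n : ℕ} (H : Matrix (Fin m) (Fin n) (ZMod 2)) (r : Fin m) : Finset (Fin n) :=
  Finset.univ.filter fun j => H r j = 1

/-- Neighbours of the variable node `j`. -/
def varNbrs {m n : ℕ} (H : Matrix (Fin m) (Fin n) (ZMod 2)) (j : Fin n) : Finset (Fin m) :=
  Finset.univ.filter fun r => H r j = 1

/-- The set `Γ(S)` of check nodes adjacent to `S`. -/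
def nbrs {m n : ℕ} (H : Matrix (Fin m) (Fin n) (ZMod 2)) (S : Finset (Fin n)) : Finset (Fin m) :=
  S.biUnion (varNbrs H)

/-- Low density: variable nodes have degree at most `δv`, check nodes degree at most `δc`. -/
def IsLDPC (δv δc : ℕ) {m n : ℕ} (H : Matrix (Fin m) (Fin n) (ZMod 2)) : Prop :=
  (∀ j, (varNbrs H j).card ≤ δv) ∧ ∀ r, (checkNbrs H r).card ≤ δc

/-- `S` is a stopping set: every check node adjacent to `S` has at least two neighbours in `S`. -/
def IsStoppingSet {m n : ℕ} (H : Matrix (Fin m) (Fin n) (ZMod 2)) (S : Finset (Fin n)) : Prop :=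
  ∀ r ∈ nbrs H S, 2 ≤ (checkNbrs H r ∩ S).card

/-- A cover stopping set is a stopping set adjacent to all check nodes. -/
def IsCoverStoppingSet {m n : ℕ} (H : Matrix (Fin m) (Fin n) (ZMod 2)) (S : Finset (Fin n)) :
    Prop :=
  IsStoppingSet H S ∧ nbrs H S = Finset.univ

/-- The smallest size `κ` of a cover stopping set; by convention `0` if there is none. -/
noncomputable def coverStoppingSize {m n : ℕ} (H : Matrix (Fin m) (Fin n) (ZMod 2)) : ℕ :=
  sInf {k | ∃ S : Finset (Fin n), IsCoverStoppingSet H S ∧ S.card = k}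

/-- The number of nodes and edges of the Tanner graph. -/
def tannerSize {m n : ℕ} (H : Matrix (Fin m) (Fin n) (ZMod 2)) : ℕ :=
  n + m + ∑ r, (checkNbrs H r).card

/-! ### Unit-cost random access programs

Programs of a random access machine with structured control flow. A program uses finitely many
integer variables and finitely many arrays, all named by numerals in the program text. The
arithmetic is addition and truncated subtraction of natural numbers (no multiplication). -/

/-- A memory state: contents of the variables and of the array cells. -/
structure State where
  var : ℕ → ℕ
  arr : ℕ → ℕ → ℕ

/-- Expressions; `cell a e` is the entry of array `a` at index `e`. -/
inductive Expr where
  | lit (c : ℕ)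
  | var (x : ℕ)
  | cell (a : ℕ) (e : Expr)
  | add (e₁ e₂ : Expr)
  | sub (e₁ e₂ : Expr)

/-- The value of an expression. -/
def Expr.eval (s : State) : Expr → ℕ
  | .lit c => c
  | .var x => s.var x
  | .cell a e => s.arr a (e.eval s)
  | .add e₁ e₂ => e₁.eval s + e₂.eval s
  | .sub e₁ e₂ => e₁.eval s - e₂.eval s

/-- The cost of evaluating an expression: one step per operation or memory access. -/
def Expr.cost : Expr → ℕ
  | .lit _ => 1
  | .var _ => 1
  | .cell _ e => e.cost + 1
  | .add e₁ e₂ => e₁.cost + e₂.cost + 1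
  | .sub e₁ e₂ => e₁.cost + e₂.cost + 1

/-- Programs. Conditions hold when the expression is nonzero. -/
inductive Prog where
  | skip
  | assign (x : ℕ) (e : Expr)
  | store (a : ℕ) (i e : Expr)
  | seq (p q : Prog)
  | cond (e : Expr) (p q : Prog)
  | loop (e : Expr) (p : Prog)

/-- Write `v` to the variable `x`. -/
def State.setVar (s : State) (x v : ℕ) : State :=
  { s with var := Function.update s.var x v }

/-- Write `v` to the cell `i` of the array `a`. -/
def State.setCell (s : State) (a i v : ℕ) : State :=
  { s with arr := Function.update s.arr a (Function.update (s.arr a) i v) }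

/-- `Exec p s s' t`: started in state `s`, program `p` halts in state `s'` after exactly `t` steps. -/
inductive Exec : Prog → State → State → ℕ → Prop where
  | skip (s : State) : Exec .skip s s 1
  | assign (s : State) (x : ℕ) (e : Expr) :
      Exec (.assign x e) s (s.setVar x (e.eval s)) (e.cost + 1)
  | store (s : State) (a : ℕ) (i e : Expr) :
      Exec (.store a i e) s (s.setCell a (i.eval s) (e.eval s)) (i.cost + e.cost + 1)
  | seq {p q : Prog} {s s' s'' : State} {t t' : ℕ} :
      Exec p s s' t → Exec q s' s'' t' → Exec (.seq p q) s s'' (t + t')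
  | cond_true {e : Expr} {p q : Prog} {s s' : State} {t : ℕ} :
      e.eval s ≠ 0 → Exec p s s' t → Exec (.cond e p q) s s' (e.cost + 1 + t)
  | cond_false {e : Expr} {p q : Prog} {s s' : State} {t : ℕ} :
      e.eval s = 0 → Exec q s s' t → Exec (.cond e p q) s s' (e.cost + 1 + t)
  | loop_done {e : Expr} {p : Prog} {s : State} :
      e.eval s = 0 → Exec (.loop e p) s s (e.cost + 1)
  | loop_step {e : Expr} {p : Prog} {s s' s'' : State} {t t' : ℕ} :
      e.eval s ≠ 0 → Exec p s s' t → Exec (.loop e p) s' s'' t' →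
      Exec (.loop e p) s s'' (e.cost + 1 + t + t')

/-! ### The problem as an input-output task for programs -/

/-- Sparse description of `H`: the numbers `n` and `m`, then for each check node its degree
followed by the list of its neighbours. -/
def encode {m n : ℕ} (H : Matrix (Fin m) (Fin n) (ZMod 2)) : List ℕ :=
  n :: m :: (List.finRange m).flatMap fun r =>
    (checkList H r).length :: (checkList H r).map Fin.val

/-- Initially array `0` holds the input list and everything else is zero. -/
def initState (l : List ℕ) : State where
  var := fun _ => 0
  arr := fun a i => if a = 0 then l.getD i 0 else 0

/-- The set of variable nodes marked by nonzero entries of array `1`. -/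
def outputSet (n : ℕ) (s : State) : Finset (Fin n) :=
  Finset.univ.filter fun j => s.arr 1 j ≠ 0

/-- The final state `s` answers the instance `H` of the minimum cover stopping set problem:
either variable `0` is `1` and array `1` marks a cover stopping set of minimum cardinality, or
variable `0` is `0` and there is no cover stopping set. -/
def CorrectAnswer {m n : ℕ} (H : Matrix (Fin m) (Fin n) (ZMod 2)) (s : State) : Prop :=
  (s.var 0 = 1 ∧ IsCoverStoppingSet H (outputSet n s) ∧
    ∀ S, IsCoverStoppingSet H S → (outputSet n s).card ≤ S.card) ∨
  (s.var 0 = 0 ∧ ¬ ∃ S, IsCoverStoppingSet H S)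

/-- On every instance with degree bounds `δv`, `δc`, the program `P` halts with a correct answer
to the minimum cover stopping set problem, after at most `T H` steps. -/
def SolvesMinCStop (δv δc : ℕ) (P : Prog)
    (T : ∀ {m n : ℕ}, Matrix (Fin m) (Fin n) (ZMod 2) → ℝ) : Prop :=
  ∀ (m n : ℕ) (H : Matrix (Fin m) (Fin n) (ZMod 2)), IsLDPC δv δc H →
    ∃ (s : State) (t : ℕ), Exec P (initState (encode H)) s t ∧ CorrectAnswer H s ∧ (t : ℝ) ≤ T H

/-- Fixed-parameter tractability in `κ`: for a computable `f` and a constant `c`, the problem is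
solved in at most `f κ · (size + 1) ^ c` steps. -/
def MinCStopIsFPT (δv δc : ℕ) : Prop :=
  ∃ (P : Prog) (f : ℕ → ℕ) (c : ℕ), Computable f ∧
    SolvesMinCStop δv δc P
      (fun H => (f (coverStoppingSize H) : ℝ) * ((tannerSize H : ℝ) + 1) ^ c)

end Tanner

/-! A check node has two neighbours in `S` iff `S` meets every set obtained from its neighbourhood
by deleting one neighbour (`hits_rowsOf`, for degree at least 1). So MinCStop becomes minimum
hitting set for rows with at most `W - 1` entries, where `W = δc`, and every element lies in at most
`Δ = δv * W` rows. If some check has degree below 2 there is no solution; otherwise the set of all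
variable nodes is one.

For a budget `k`, pick a row and branch on its entries: select `x` and drop the rows with `x`, or
else delete `x` from all rows and go on to the next entry. Plain branching gives growth `W - 1`. Two
refinements lower it to `β`, the root of `β ^ 2 = (W - 2) * β + 1`: an entry dominated by another
entry of the row is deleted without trying it, and a row with two deleted entries is preferred. Give
an instance weight 1 if it has such a row, and `τ = β - W + 3` otherwise. If the first entry `x` is
not dominated, then every other entry `y` is missing from some row with `x`; after the deletion of
`x` this row has two deleted entries and survives the selection of `y`, so all later children have
weight 1. Since `τ + (W - 3) = β` and `τ + (W - 2) = τ * β`, the children weigh at most `β` times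
their parent (`childSum_le`).

No polynomial factor remains. More than `Δ * k` rows cannot be hit by `k` elements
(`Hits.length_le`), so the work at a node is linear in its budget, and the recurrence `T (k + 1) = β
* T k + c * (k + 2)` has solutions of order `β ^ k` because the sum of `(i + 1) / β ^ i` converges
(`overhead_bounded`, `search_spec`). Trying the budgets 0, 1, 2, … up to `κ` gives a geometric sum,
and recopying the rows costs a quadratic term in `κ`, absorbed by `β ^ κ`. Reading takes time linear
in the number of edges, at most `δv * n`. Tractability follows from the same program and `β ≤ δc`.
-/

namespace Tanner

/-! ### Execution within a time bound -/

/-- Started in `s`, the program `p` halts in `s'` after at most `T` steps. -/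
def Does (p : Prog) (s s' : State) (T : ℕ) : Prop := ∃ t ≤ T, Exec p s s' t

theorem Does.mono {p : Prog} {s s' : State} {T T' : ℕ} (h : Does p s s' T) (hT : T ≤ T') :
    Does p s s' T' :=
  let ⟨t, ht, he⟩ := h
  ⟨t, ht.trans hT, he⟩

theorem Does.seq {p q : Prog} {s s' s'' : State} {T T' : ℕ} (h : Does p s s' T)
    (h' : Does q s' s'' T') : Does (.seq p q) s s'' (T + T') :=
  let ⟨_, ht, he⟩ := h
  let ⟨_, ht', he'⟩ := h'
  ⟨_, Nat.add_le_add ht ht', .seq he he'⟩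

theorem Does.cond_true {e : Expr} {p q : Prog} {s s' : State} {T : ℕ} (he : e.eval s ≠ 0)
    (h : Does p s s' T) : Does (.cond e p q) s s' (e.cost + 1 + T) :=
  let ⟨_, ht, hx⟩ := h
  ⟨_, Nat.add_le_add le_rfl ht, .cond_true he hx⟩

theorem Does.cond_false {e : Expr} {p q : Prog} {s s' : State} {T : ℕ} (he : e.eval s = 0)
    (h : Does q s s' T) : Does (.cond e p q) s s' (e.cost + 1 + T) :=
  let ⟨_, ht, hx⟩ := h
  ⟨_, Nat.add_le_add le_rfl ht, .cond_false he hx⟩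

theorem Does.loop_done {e : Expr} {p : Prog} {s : State} (he : e.eval s = 0) :
    Does (.loop e p) s s (e.cost + 1) :=
  ⟨_, le_rfl, .loop_done he⟩

theorem Does.loop_step {e : Expr} {p : Prog} {s s' s'' : State} {T T' : ℕ} (he : e.eval s ≠ 0)
    (h : Does p s s' T) (h' : Does (.loop e p) s' s'' T') :
    Does (.loop e p) s s'' (e.cost + 1 + T + T') :=
  let ⟨_, ht, hx⟩ := h
  let ⟨_, ht', hx'⟩ := h'
  ⟨_, by omega, .loop_step he hx hx'⟩

/-- Programs without loops. -/
def Prog.LoopFree : Prog → Prop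
  | .skip => True
  | .assign _ _ => True
  | .store _ _ _ => True
  | .seq p q => p.LoopFree ∧ q.LoopFree
  | .cond _ p q => p.LoopFree ∧ q.LoopFree
  | .loop _ _ => False

/-- The effect of a loop-free program. -/
def Prog.run : Prog → State → State
  | .skip, s => s
  | .assign x e, s => s.setVar x (e.eval s)
  | .store a i e, s => s.setCell a (i.eval s) (e.eval s)
  | .seq p q, s => q.run (p.run s)
  | .cond e p q, s => if e.eval s = 0 then q.run s else p.run s
  | .loop _ _, s => s

/-- A bound for the running time of a loop-free program. -/
def Prog.bound : Prog → ℕ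
  | .skip => 1
  | .assign _ e => e.cost + 1
  | .store _ i e => i.cost + e.cost + 1
  | .seq p q => p.bound + q.bound
  | .cond e p q => e.cost + 1 + (p.bound + q.bound)
  | .loop _ _ => 0

/-- Only constants are at stake here, so `Prog.bound` adds the two branches of a conditional rather
than taking the larger. -/
theorem Prog.LoopFree.does {p : Prog} (hp : p.LoopFree) (s : State) :
    Does p s (p.run s) p.bound := by
  induction p generalizing s with
  | skip => exact ⟨_, le_rfl, .skip s⟩
  | assign x e => exact ⟨_, le_rfl, .assign s x e⟩
  | store a i e => exact ⟨_, le_rfl, .store s a i e⟩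
  | seq p q ihp ihq => exact (ihp hp.1 s).seq (ihq hp.2 _)
  | cond e p q ihp ihq =>
    by_cases he : e.eval s = 0
    · simp only [Prog.run, he, if_true]
      exact (Does.cond_false he (ihq hp.2 s)).mono (by simp [Prog.bound])
    · simp only [Prog.run, he, if_false]
      exact (Does.cond_true he (ihp hp.1 s)).mono (by simp [Prog.bound])
  | loop e p => exact hp.elim

/-- `P 0`, …, `P (n - 1)` in sequence. -/
def unroll : ℕ → (ℕ → Prog) → Prog
  | 0, _ => .skip
  | n + 1, P => .seq (unroll n P) (P n)

theorem unroll_loopFree {P : ℕ → Prog} (hP : ∀ t, (P t).LoopFree) (n : ℕ) :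
    (unroll n P).LoopFree := by
  induction n with
  | zero => trivial
  | succ n ih => exact ⟨ih, hP n⟩

theorem unroll_does {P : ℕ → Prog} {n c : ℕ} (I : ℕ → State → Prop)
    (hstep : ∀ t < n, ∀ s, I t s → ∃ s', Does (P t) s s' c ∧ I (t + 1) s') {s : State}
    (h0 : I 0 s) : ∃ s', Does (unroll n P) s s' (n * c + 1) ∧ I n s' := by
  induction n with
  | zero => exact ⟨s, ⟨1, by omega, .skip s⟩, h0⟩
  | succ n ih =>
    obtain ⟨s₁, h₁, hI⟩ := ih fun t ht => hstep t (by omega)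
    obtain ⟨s₂, h₂, hI'⟩ := hstep n (by omega) s₁ hI
    exact ⟨s₂, (h₁.seq h₂).mono (by rw [Nat.add_mul]; omega), hI'⟩

/-- Running the loop `while e do p` from `s` leads to `s'` within `T` steps, the loop not being
finished: whatever remains to be done from `s'` can be done from `s` with at most `T` more steps. -/
def Steps (e : Expr) (p : Prog) (s s' : State) (T : ℝ) : Prop :=
  ∀ s'' t', Exec (.loop e p) s' s'' t' → ∃ t : ℕ, Exec (.loop e p) s s'' t ∧ (t : ℝ) ≤ T + t'

/-- The recursion runs inside a single loop with an explicit stack, so a recursive call is a segment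
of a run and not a program. Quantifying over continuations makes such segments compose, with times
added. -/
theorem Steps.trans {e : Expr} {p : Prog} {s s' s'' : State} {T T' : ℝ} (h : Steps e p s s' T)
    (h' : Steps e p s' s'' T') : Steps e p s s'' (T + T') := by
  intro u t hu
  obtain ⟨t₁, h₁, ht₁⟩ := h' u t hu
  obtain ⟨t₂, h₂, ht₂⟩ := h u t₁ h₁
  exact ⟨t₂, h₂, by linarith⟩

theorem Steps.mono {e : Expr} {p : Prog} {s s' : State} {T T' : ℝ} (h : Steps e p s s' T)
    (hT : T ≤ T') : Steps e p s s' T' := by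
  intro u t hu
  obtain ⟨t₁, h₁, ht₁⟩ := h u t hu
  exact ⟨t₁, h₁, by linarith⟩

theorem Does.steps {e : Expr} {p : Prog} {s s' : State} {c : ℕ} (he : e.eval s ≠ 0)
    (h : Does p s s' c) : Steps e p s s' ((e.cost + 1 + c : ℕ) : ℝ) := by
  intro u t hu
  obtain ⟨t₁, ht₁, h₁⟩ := h
  refine ⟨_, .loop_step he h₁ hu, ?_⟩
  have : e.cost + 1 + t₁ + t ≤ e.cost + 1 + c + t := by omega
  exact_mod_cast this

/-! ### Derived expressions -/

/-- An expression that vanishes iff `e₁` and `e₂` have the same value. -/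
def neqE (e₁ e₂ : Expr) : Expr := .add (.sub e₁ e₂) (.sub e₂ e₁)

/-- An expression with value `1` if `e₁` and `e₂` have the same value, and `0` otherwise. -/
def eqE (e₁ e₂ : Expr) : Expr := .sub (.lit 1) (neqE e₁ e₂)

/-- The `c`-fold of an expression. -/
def mulE : ℕ → Expr → Expr
  | 0, _ => .lit 0
  | c + 1, e => .add (mulE c e) e

/-- The number of entries equal to `y` among the first `n` entries of the row `r`. -/
def cnt (n : ℕ) (r : ℕ → ℕ) (y : ℕ) : ℕ := ∑ t ∈ Finset.range n, if r t = y then 1 else 0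

/-- The number of cells with the value of `y` among the first `n` cells of array `2` from `p`. -/
def countE : ℕ → Expr → Expr → Expr
  | 0, _, _ => .lit 0
  | n + 1, p, y => .add (countE n p y) (eqE (.cell 2 (.add p (.lit n))) y)

@[simp] theorem neqE_eval_eq_zero (s : State) (e₁ e₂ : Expr) :
    (neqE e₁ e₂).eval s = 0 ↔ e₁.eval s = e₂.eval s := by
  simp only [neqE, Expr.eval]; omega

@[simp] theorem eqE_eval (s : State) (e₁ e₂ : Expr) :
    (eqE e₁ e₂).eval s = if e₁.eval s = e₂.eval s then 1 else 0 := by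
  simp only [eqE, neqE, Expr.eval]; split_ifs <;> omega

@[simp] theorem mulE_eval (s : State) (c : ℕ) (e : Expr) : (mulE c e).eval s = c * e.eval s := by
  induction c with
  | zero => simp [mulE, Expr.eval]
  | succ c ih => simp only [mulE, Expr.eval, ih]; ring

@[simp] theorem countE_eval (s : State) (n : ℕ) (p y : Expr) :
    (countE n p y).eval s = cnt n (fun t => s.arr 2 (p.eval s + t)) (y.eval s) := by
  induction n with
  | zero => simp [countE, cnt, Expr.eval]
  | succ n ih =>
    simp only [countE, Expr.eval, ih, eqE_eval]
    exact (Finset.sum_range_succ _ n).symm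

@[simp] theorem setVar_var (s : State) (x v y : ℕ) :
    (s.setVar x v).var y = if y = x then v else s.var y := by
  simp [State.setVar, Function.update_apply]

@[simp] theorem setVar_arr (s : State) (x v : ℕ) : (s.setVar x v).arr = s.arr := rfl

@[simp] theorem setCell_var (s : State) (a i v : ℕ) : (s.setCell a i v).var = s.var := rfl

@[simp] theorem setCell_arr (s : State) (a i v b j : ℕ) :
    (s.setCell a i v).arr b j = if b = a ∧ j = i then v else s.arr b j := by
  by_cases hb : b = a
  · subst hb; by_cases hj : j = i <;> simp [State.setCell, hj]
  · simp [State.setCell, hb]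

@[simp] theorem setCell_arr_of_ne (s : State) {a b : ℕ} (i v : ℕ) (h : b ≠ a) :
    (s.setCell a i v).arr b = s.arr b := by
  funext j; simp [h]

/-! ### Rows and hitting sets

A row is a list of `W` entries; the entry `0` stands for a deleted entry. -/

/-- The value `x` is an entry of the row `r` of width `W`. -/
def Mem (W x : ℕ) (r : ℕ → ℕ) : Prop := ∃ t < W, r t = x

theorem cnt_pos {W x : ℕ} {r : ℕ → ℕ} : 0 < cnt W r x ↔ Mem W x r := by
  unfold cnt Mem
  rw [Finset.sum_pos_iff]
  refine exists_congr fun t => and_congr Finset.mem_range ?_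
  split_ifs with h <;> simp [h]

theorem cnt_eq_zero {W x : ℕ} {r : ℕ → ℕ} : cnt W r x = 0 ↔ ¬ Mem W x r := by
  rw [← cnt_pos]; omega

theorem cnt_le (W x : ℕ) (r : ℕ → ℕ) : cnt W r x ≤ W := by
  calc cnt W r x ≤ ∑ t ∈ Finset.range W, 1 :=
        Finset.sum_le_sum fun t _ => by split_ifs <;> omega
    _ = W := by simp

theorem cnt_congr {W x : ℕ} {r r' : ℕ → ℕ} (h : ∀ t < W, r t = r' t) : cnt W r x = cnt W r' x :=
  Finset.sum_congr rfl fun t ht => by rw [h t (Finset.mem_range.1 ht)]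

/-- Delete the entry `x` from a row. -/
def delRow (x : ℕ) (r : ℕ → ℕ) : ℕ → ℕ := fun t => if r t = x then 0 else r t

/-- Delete the entry `x` from all rows. -/
def del (x : ℕ) (F : List (ℕ → ℕ)) : List (ℕ → ℕ) := F.map (delRow x)

open Classical in
/-- The rows without the entry `x`. -/
noncomputable def drop (W x : ℕ) (F : List (ℕ → ℕ)) : List (ℕ → ℕ) := F.filter fun r => ¬ Mem W x r

/-- The set `S` hits all rows of `F`. -/
def Hits (W : ℕ) (F : List (ℕ → ℕ)) (S : Finset ℕ) : Prop :=
  ∀ r ∈ F, ∃ x ∈ S, x ≠ 0 ∧ Mem W x r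

open Classical in
/-- The number of rows with the entry `x`. -/
noncomputable def occ (W x : ℕ) (F : List (ℕ → ℕ)) : ℕ := F.countP fun r => Mem W x r

theorem mem_delRow {W x y : ℕ} {r : ℕ → ℕ} (hy : y ≠ 0) :
    Mem W y (delRow x r) ↔ y ≠ x ∧ Mem W y r := by
  constructor
  · rintro ⟨t, ht, h⟩
    unfold delRow at h
    split_ifs at h with hx
    · exact absurd h.symm hy
    · exact ⟨fun h' => hx (h.trans h'), t, ht, h⟩
  · rintro ⟨hyx, t, ht, h⟩
    exact ⟨t, ht, by simp [delRow, h, hyx]⟩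

theorem mem_drop {W x : ℕ} {F : List (ℕ → ℕ)} {r : ℕ → ℕ} :
    r ∈ drop W x F ↔ r ∈ F ∧ ¬ Mem W x r := by
  simp [drop]

theorem cnt_delRow_le {W x : ℕ} (r : ℕ → ℕ) : cnt W r 0 ≤ cnt W (delRow x r) 0 := by
  refine Finset.sum_le_sum fun t _ => ?_
  unfold delRow
  split_ifs <;> simp_all

theorem cnt_delRow_lt {W x : ℕ} {r : ℕ → ℕ} (hx : x ≠ 0) (h : Mem W x r) :
    cnt W r 0 < cnt W (delRow x r) 0 := by
  obtain ⟨t, ht, htx⟩ := h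
  refine Finset.sum_lt_sum (fun t _ => ?_) ⟨t, Finset.mem_range.2 ht, ?_⟩
  · unfold delRow
    split_ifs <;> simp_all
  · simp [delRow, htx, hx]

/-- Soundness of selecting `x`: what is left of the hitting set must take care of the rows that
avoid `x`, with one element fewer. -/
theorem Hits.drop {W x k : ℕ} {F : List (ℕ → ℕ)} {S : Finset ℕ} (h : Hits W F S) (hx : x ∈ S)
    (hk : S.card ≤ k + 1) : Hits W (drop W x F) (S.erase x) ∧ (S.erase x).card ≤ k := by
  refine ⟨fun r hr => ?_, by rw [Finset.card_erase_of_mem hx]; omega⟩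
  obtain ⟨hr, hxr⟩ := mem_drop.1 hr
  obtain ⟨y, hy, hy0, hyr⟩ := h r hr
  exact ⟨y, Finset.mem_erase.2 ⟨fun h => hxr (h ▸ hyr), hy⟩, hy0, hyr⟩

/-- Soundness of rejecting `x`: a hitting set without `x` hits each row at another entry. -/
theorem Hits.del {W x : ℕ} {F : List (ℕ → ℕ)} {S : Finset ℕ} (h : Hits W F S) (hx : x ∉ S) :
    Hits W (del x F) S := by
  intro r' hr'
  obtain ⟨r, hr, rfl⟩ := List.mem_map.1 hr'
  obtain ⟨y, hy, hy0, hyr⟩ := h r hr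
  exact ⟨y, hy, hy0, (mem_delRow hy0).2 ⟨fun h => hx (h ▸ hy), hyr⟩⟩

/-- Exchange argument: `y` takes the place of `x`. Hence a dominated entry may be deleted without
trying it. -/
theorem Hits.of_dominated {W x y : ℕ} {F : List (ℕ → ℕ)} {S : Finset ℕ} (h : Hits W F S)
    (hy : y ≠ 0) (hyx : y ≠ x) (hd : ∀ r ∈ F, Mem W x r → Mem W y r) :
    ∃ S' : Finset ℕ, Hits W F S' ∧ x ∉ S' ∧ S'.card ≤ S.card := by
  by_cases hx : x ∈ S
  · refine ⟨insert y (S.erase x), fun r hr => ?_, by simp [hyx.symm], ?_⟩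
    · obtain ⟨z, hz, hz0, hzr⟩ := h r hr
      by_cases hzx : z = x
      · exact ⟨y, Finset.mem_insert_self _ _, hy, hd r hr (hzx ▸ hzr)⟩
      · exact ⟨z, Finset.mem_insert_of_mem (Finset.mem_erase.2 ⟨hzx, hz⟩), hz0, hzr⟩
    · refine (Finset.card_insert_le _ _).trans ?_
      rw [Finset.card_erase_of_mem hx]
      have := Finset.card_pos.2 ⟨x, hx⟩
      omega
  · exact ⟨S, h, hx, le_rfl⟩

/-- Each element hits at most `Δ` rows. This justifies the cutoff of the search and keeps the work
at a node linear in its budget. -/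
theorem Hits.length_le {W Δ : ℕ} {F : List (ℕ → ℕ)} {S : Finset ℕ} (h : Hits W F S)
    (ho : ∀ x, x ≠ 0 → occ W x F ≤ Δ) : F.length ≤ Δ * S.card := by
  classical
  have key : F.length ≤ ∑ x ∈ S.filter (· ≠ 0), occ W x F := by
    clear ho
    induction F with
    | nil => simp
    | cons r F ih =>
      have ih := ih fun r' hr' => h r' (List.mem_cons_of_mem _ hr')
      obtain ⟨x, hx, hx0, hxr⟩ := h r List.mem_cons_self
      have : ∑ x ∈ S.filter (· ≠ 0), occ W x F < ∑ x ∈ S.filter (· ≠ 0), occ W x (r :: F) := by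
        refine Finset.sum_lt_sum (fun y _ => ?_) ⟨x, Finset.mem_filter.2 ⟨hx, hx0⟩, ?_⟩
        · simp only [occ, List.countP_cons]; omega
        · simp [occ, hxr]
      simp only [List.length_cons]
      omega
  calc F.length ≤ ∑ x ∈ S.filter (· ≠ 0), occ W x F := key
    _ ≤ ∑ x ∈ S.filter (· ≠ 0), Δ :=
      Finset.sum_le_sum fun x hx => ho x (Finset.mem_filter.1 hx).2
    _ = (S.filter (· ≠ 0)).card * Δ := by simp
    _ ≤ S.card * Δ := Nat.mul_le_mul_right _ (Finset.card_filter_le _ _)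
    _ = Δ * S.card := mul_comm _ _

/-- Rows have a deleted entry, and entries occur in at most `Δ` rows. -/
def Sparse (W Δ : ℕ) (F : List (ℕ → ℕ)) : Prop :=
  (∀ r ∈ F, 1 ≤ cnt W r 0) ∧ ∀ x, x ≠ 0 → occ W x F ≤ Δ

theorem Sparse.drop {W Δ x : ℕ} {F : List (ℕ → ℕ)} (h : Sparse W Δ F) :
    Sparse W Δ (drop W x F) := by
  refine ⟨fun r hr => h.1 r (mem_drop.1 hr).1, fun y hy => le_trans ?_ (h.2 y hy)⟩
  exact List.Sublist.countP_le List.filter_sublist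

theorem Sparse.del {W Δ x : ℕ} {F : List (ℕ → ℕ)} (h : Sparse W Δ F) :
    Sparse W Δ (del x F) := by
  refine ⟨fun r' hr' => ?_, fun y hy => le_trans ?_ (h.2 y hy)⟩
  · obtain ⟨r, hr, rfl⟩ := List.mem_map.1 hr'
    exact (h.1 r hr).trans (cnt_delRow_le r)
  · unfold Tanner.del occ
    rw [List.countP_map]
    refine List.countP_mono_left fun r _ hr => ?_
    simpa using ((mem_delRow hy).1 (by simpa using hr)).2

/-! ### The weight of an instance -/

open Classical in
/-- The weight is `1` if some row has two deleted entries, and `τ` otherwise. -/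
noncomputable def wt (W : ℕ) (τ : ℝ) (F : List (ℕ → ℕ)) : ℝ :=
  if ∃ r ∈ F, 2 ≤ cnt W r 0 then 1 else τ

/-- Some other entry of the row `e` belongs to all rows with the entry `x`. -/
def Dominated (W : ℕ) (F : List (ℕ → ℕ)) (x : ℕ) (e : ℕ → ℕ) : Prop :=
  ∃ t < W, e t ≠ 0 ∧ e t ≠ x ∧ ∀ r ∈ F, Mem W x r → Mem W (e t) r

open Classical in
/-- The total weight of the branches on the last `j` entries of the row `e`. -/
noncomputable def childSum (W : ℕ) (τ : ℝ) : ℕ → List (ℕ → ℕ) → (ℕ → ℕ) → ℝ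
  | 0, _, _ => 0
  | j + 1, F, e =>
    if e (W - (j + 1)) = 0 then childSum W τ j F e
    else (if Dominated W F (e (W - (j + 1))) e then 0 else wt W τ (drop W (e (W - (j + 1))) F)) +
      childSum W τ j (del (e (W - (j + 1))) F) (delRow (e (W - (j + 1))) e)

/-- The number of nonzero entries among the last `j` entries of the row `e`. -/
def nz (W : ℕ) : ℕ → (ℕ → ℕ) → ℕ
  | 0, _ => 0
  | j + 1, e => (if e (W - (j + 1)) = 0 then 0 else 1) + nz W j e

theorem nz_delRow_le (W x j : ℕ) (e : ℕ → ℕ) : nz W j (delRow x e) ≤ nz W j e := by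
  induction j with
  | zero => exact le_rfl
  | succ j ih =>
    simp only [nz]
    have : delRow x e (W - (j + 1)) = 0 ∨ delRow x e (W - (j + 1)) = e (W - (j + 1)) := by
      unfold delRow; split_ifs <;> simp
    rcases this with h | h <;> simp only [h, if_true] <;> omega

theorem nz_add_cnt (W : ℕ) (e : ℕ → ℕ) : nz W W e + cnt W e 0 = W := by
  suffices ∀ j ≤ W, nz W j e + cnt W e 0 = j + cnt (W - j) e 0 by simpa [cnt] using this W le_rfl
  intro j
  induction j with
  | zero => simp [nz]
  | succ j ih =>
    intro hj
    have h := ih (by omega)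
    obtain ⟨w, hw⟩ : ∃ w, W - j = w + 1 := ⟨W - j - 1, by omega⟩
    have hw' : W - (j + 1) = w := by omega
    rw [hw] at h
    simp only [nz, hw', cnt, Finset.sum_range_succ] at h ⊢
    split_ifs at h ⊢ <;> omega

theorem wt_le {W : ℕ} {τ : ℝ} (hτ : 1 ≤ τ) (F : List (ℕ → ℕ)) : wt W τ F ≤ τ := by
  unfold wt; split_ifs <;> simp [hτ]

theorem one_le_wt {W : ℕ} {τ : ℝ} (hτ : 1 ≤ τ) (F : List (ℕ → ℕ)) : 1 ≤ wt W τ F := by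
  unfold wt; split_ifs <;> simp [hτ]

theorem childSum_nonneg {W : ℕ} {τ : ℝ} (hτ : 1 ≤ τ) (j : ℕ) (F : List (ℕ → ℕ)) (e : ℕ → ℕ) :
    0 ≤ childSum W τ j F e := by
  induction j generalizing F e with
  | zero => simp [childSum]
  | succ j ih =>
    have hw := one_le_wt (W := W) hτ (drop W (e (W - (j + 1))) F)
    have h1 := ih F e
    have h2 := ih (del (e (W - (j + 1))) F) (delRow (e (W - (j + 1))) e)
    simp only [childSum]
    split_ifs <;> linarith

theorem childSum_le_mul {W : ℕ} {τ : ℝ} (hτ : 1 ≤ τ) (j : ℕ) (F : List (ℕ → ℕ)) (e : ℕ → ℕ) :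
    childSum W τ j F e ≤ nz W j e * τ := by
  induction j generalizing F e with
  | zero => simp [childSum, nz]
  | succ j ih =>
    have hw := wt_le (W := W) hτ (drop W (e (W - (j + 1))) F)
    have h1 := ih F e
    have h2 := ih (del (e (W - (j + 1))) F) (delRow (e (W - (j + 1))) e)
    have h3 : (nz W j (delRow (e (W - (j + 1))) e) : ℝ) * τ ≤ nz W j e * τ :=
      mul_le_mul_of_nonneg_right (by exact_mod_cast nz_delRow_le _ _ _ _) (by linarith)
    simp only [childSum, nz]
    split_ifs <;> push_cast <;> nlinarith

/-- A row with two deleted entries that avoids `e t` survives the selection of `e t`, so that child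
has weight 1. Deleting further entries preserves this situation. -/
theorem childSum_le_nz {W : ℕ} {τ : ℝ} {j : ℕ} (hj : j ≤ W) {F : List (ℕ → ℕ)} {e : ℕ → ℕ}
    (h : ∀ t < W, e t ≠ 0 → ∃ r ∈ F, 2 ≤ cnt W r 0 ∧ ¬ Mem W (e t) r) :
    childSum W τ j F e ≤ nz W j e := by
  induction j generalizing F e with
  | zero => simp [childSum, nz]
  | succ j ih =>
    simp only [childSum, nz]
    by_cases hx : e (W - (j + 1)) = 0
    · simpa [hx] using ih (by omega) h
    · set x := e (W - (j + 1)) with hxdef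
      obtain ⟨r, hr, hr2, hxr⟩ := h (W - (j + 1)) (by omega) hx
      have hw : wt W τ (drop W x F) = 1 := if_pos ⟨r, mem_drop.2 ⟨hr, hxr⟩, hr2⟩
      have h2 := ih (by omega) (F := del x F) (e := delRow x e) (by
        intro t ht h0
        have he : delRow x e t = e t := by
          unfold delRow at h0 ⊢; split_ifs at h0 ⊢ <;> simp_all
        rw [he] at h0 ⊢
        obtain ⟨r, hr, hr2, htr⟩ := h t ht h0
        exact ⟨delRow x r, List.mem_map_of_mem hr, hr2.trans (cnt_delRow_le r),
          fun h' => htr ((mem_delRow h0).1 h').2⟩)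
      have h3 : (nz W j (delRow x e) : ℝ) ≤ nz W j e := by exact_mod_cast nz_delRow_le _ _ _ _
      rw [if_neg hx, if_neg hx, hw]
      push_cast
      split_ifs <;> linarith

/-- The two terms correspond to the first remaining nonzero entry being tried, after which all
children have weight 1, or being dominated, which saves one child. -/
theorem childSum_le_max {W : ℕ} {τ : ℝ} (hτ : 1 ≤ τ) {j N : ℕ} (hj : j ≤ W)
    {F : List (ℕ → ℕ)} {e : ℕ → ℕ} (hF : ∀ r ∈ F, 1 ≤ cnt W r 0) (hN : nz W j e ≤ N + 1) :
    childSum W τ j F e ≤ max (τ + N) (N * τ) := by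
  induction j with
  | zero => exact le_max_of_le_left (by simp only [childSum]; positivity)
  | succ j ih =>
    simp only [childSum]
    simp only [nz] at hN
    by_cases hx : e (W - (j + 1)) = 0
    · simpa [hx] using ih (by omega) (by simpa [hx] using hN)
    · rw [if_neg hx]
      rw [if_neg hx] at hN
      set x := e (W - (j + 1)) with hxdef
      have hN' : (nz W j (delRow x e) : ℝ) ≤ N := by
        have := nz_delRow_le W x j e
        exact_mod_cast (show nz W j (delRow x e) ≤ N by omega)
      by_cases hd : Dominated W F x e
      · rw [if_pos hd]
        -- The dominated entry has no child; at most `N` others remain, of weight at most `τ` each.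
        refine le_max_of_le_right ?_
        have := childSum_le_mul hτ j (del x F) (delRow x e) (W := W)
        nlinarith
      · rw [if_neg hd]
        refine le_max_of_le_left (add_le_add (wt_le hτ _) (le_trans ?_ hN'))
        -- As `x` is not dominated, some row has `x` but not `e t`. It already had one deleted
        -- entry, and the deletion of `x` gives it a second.
        refine childSum_le_nz (by omega) fun t ht h0 => ?_
        have he : delRow x e t = e t ∧ e t ≠ x := by
          unfold delRow at h0 ⊢; split_ifs at h0 ⊢ <;> simp_all
        rw [he.1] at h0 ⊢
        unfold Dominated at hd
        push Not at hd
        obtain ⟨r, hr, hxr, htr⟩ := hd t ht h0 he.2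
        exact ⟨delRow x r, List.mem_map_of_mem hr,
          (Nat.succ_le_succ (hF r hr)).trans (cnt_delRow_lt hx hxr),
          fun h' => htr ((mem_delRow h0).1 h').2⟩

/-- The value of `τ` balances the two kinds of instances: with `W = u + 3`, it gives `τ + u = β`
when there is a row with two deleted entries, and `τ + u + 1 = τ * β` when there is none. -/
theorem childSum_le {W : ℕ} (hW : 3 ≤ W) {β τ : ℝ} (hβ : β ^ 2 = (W - 2) * β + 1) (hβ0 : 1 < β)
    (hτ : τ = β - W + 3) {F : List (ℕ → ℕ)} (hF : ∀ r ∈ F, 1 ≤ cnt W r 0) {e : ℕ → ℕ}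
    (he : e ∈ F) (hsmall : (∃ r ∈ F, 2 ≤ cnt W r 0) → 2 ≤ cnt W e 0) :
    childSum W τ W F e ≤ wt W τ F * β := by
  obtain ⟨u, rfl⟩ := Nat.exists_eq_add_of_le' hW
  push_cast at hβ hτ
  have hu : (0 : ℝ) ≤ u := u.cast_nonneg
  have hβu : (u : ℝ) + 1 < β := by nlinarith
  have hτ1 : 1 ≤ τ := by linarith
  have hnz := nz_add_cnt (u + 3) e
  unfold wt
  split_ifs with hs
  · have h2 := hsmall hs
    -- From `β * (β - u - 1) = 1` the first factor is `1 / β`, and `u - 1 < β`. Expanded, this is `u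
    -- * τ ≤ β`.
    have h3 : (β - u - 1) * (u - 1) ≤ 1 := by nlinarith
    refine (childSum_le_max hτ1 (N := u) le_rfl hF (by omega)).trans (max_le ?_ ?_)
    · linarith
    · rw [hτ]; nlinarith
  · have h1 := hF e he
    -- The first bound holds with equality, as `τ + u + 1 = β + 1 = τ * β`; the second is `u + 1 <
    -- β`.
    refine (childSum_le_max hτ1 (N := u + 1) le_rfl hF (by omega)).trans (max_le ?_ ?_)
    · push_cast; nlinarith
    · push_cast; nlinarith

/-! ### Blocks of rows in memory -/

/-- The array `a` holds the rows of a list consecutively from the address `b` on. -/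
def Blk (W : ℕ) (a : ℕ → ℕ) : ℕ → List (ℕ → ℕ) → Prop
  | _, [] => True
  | b, r :: F => (∀ t < W, a (b + t) = r t) ∧ Blk W a (b + W) F

theorem Blk.congr {W : ℕ} {a a' : ℕ → ℕ} {b : ℕ} {F : List (ℕ → ℕ)} (h : Blk W a b F)
    (ha : ∀ i, b ≤ i → i < b + W * F.length → a' i = a i) : Blk W a' b F := by
  induction F generalizing b with
  | nil => trivial
  | cons r F ih =>
    simp only [List.length_cons, Nat.mul_succ] at ha
    refine ⟨fun t ht => ?_, ih h.2 fun i h1 h2 => ha i (by omega) (by omega)⟩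
    rw [ha (b + t) (by omega) (by omega), h.1 t ht]

theorem Blk.get {W : ℕ} {a : ℕ → ℕ} {b : ℕ} {F : List (ℕ → ℕ)} (h : Blk W a b F) {i t : ℕ}
    (hi : i < F.length) (ht : t < W) : a (b + W * i + t) = F[i] t := by
  induction F generalizing b i with
  | nil => simp at hi
  | cons r F ih =>
    cases i with
    | zero => simpa using h.1 t ht
    | succ i =>
      have := ih h.2 (i := i) (by simpa using hi)
      simp only [List.getElem_cons_succ, ← this]
      congr 1; ring

/-! ### The search program

Variables: `0` answer, `1` number of variable nodes, `2` number of checks left, `3` read position,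
`4` whether all degrees are at least `2`, `5` current degree, `6` and `17` source and target
addresses, `7` current entry, `8` candidate for a dominating entry, `9` number of rows against it,
`10` whether the current entry is dominated, `11` top frame of the stack, `12` phase of the top
frame, `13` size bound, `14` whether a solution was found, `15` end of the solution, `16` end of the
current block, `18` address of the selected row.

Arrays: `0` input, `1` output, `2` rows, `3` selected entry of each frame, `4` start of the block of
each frame, `5` address of the row to branch on, `6` number of entries left to branch on. -/

/-- Count in variable `9` the rows of the current block with the entry `7` but not the entry `8`. -/
def domLoop (W : ℕ) : Prog :=
  .loop (.sub (.var 16) (.var 6))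
    (.seq (.assign 9 (.add (.var 9)
        (.sub (countE W (.var 6) (.var 7)) (mulE W (countE W (.var 6) (.var 8))))))
      (.assign 6 (.add (.var 6) (.lit W))))

theorem domLoop_spec {W : ℕ} (hW : 0 < W) : ∃ c, ∀ (F : List (ℕ → ℕ)) (s : State),
    Blk W (s.arr 2) (s.var 6) F → s.var 16 = s.var 6 + W * F.length →
    ∃ s', Does (domLoop W) s s' (c * (F.length + 1)) ∧
      (s'.var 9 = 0 ↔ s.var 9 = 0 ∧ ∀ r ∈ F, Mem W (s.var 7) r → Mem W (s.var 8) r) ∧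
      (∀ v, v ≠ 6 → v ≠ 9 → s'.var v = s.var v) ∧ s'.arr = s.arr := by
  unfold domLoop
  generalize hb : Prog.seq _ _ = body
  refine ⟨(Expr.sub (.var 16) (.var 6)).cost + 1 + body.bound, fun F => ?_⟩
  induction F with
  | nil =>
    intro s _ h16
    refine ⟨s, (Does.loop_done ?_).mono (by simp), by simp, by simp, rfl⟩
    simp [Expr.eval, h16]
  | cons r F ih =>
    intro s hF h16
    have hbody : body.LoopFree := by subst hb; exact ⟨trivial, trivial⟩
    simp only [List.length_cons, Nat.mul_succ] at h16
    set s₁ := body.run s with hs₁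
    subst hb
    simp only [Prog.run] at hs₁
    obtain ⟨s', hd, h9, hv, ha⟩ := ih s₁ (by simpa [hs₁, Expr.eval] using hF.2)
      (by simp [hs₁, Expr.eval, h16]; ring)
    refine ⟨s', (Does.loop_step (by simp [Expr.eval]; omega) (hbody.does s) hd).mono ?_, ?_, ?_, ?_⟩
    · simp only [List.length_cons, Nat.mul_succ]; omega
    · rw [h9]
      have h1 : ∀ y, cnt W (fun t => s.arr 2 (s.var 6 + t)) y = cnt W r y :=
        fun y => cnt_congr hF.1
      -- A value occurs at most `W` times in a row, so with the factor `W` a single occurrence of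
      -- the candidate makes the truncated difference vanish.
      have h2 : cnt W r (s.var 7) - W * cnt W r (s.var 8) = 0 ↔
          (Mem W (s.var 7) r → Mem W (s.var 8) r) := by
        rw [← cnt_pos, ← cnt_pos, Nat.sub_eq_zero_iff_le]
        constructor
        · intro h h'
          by_contra h0
          have : cnt W r (s.var 8) = 0 := by omega
          simp [this] at h; omega
        · intro h
          rcases Nat.eq_zero_or_pos (cnt W r (s.var 7)) with h0 | h0
          · omega
          · exact (cnt_le W _ r).trans (Nat.le_mul_of_pos_right W (h h0))
      simp [hs₁, Expr.eval, h1, h2, and_assoc]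
    · intro v h6 h9
      rw [hv v h6 h9]
      simp [hs₁, h6, h9]
    · rw [ha]; simp [hs₁]

/-- Set variable `10` to a nonzero value if the entry `7` is dominated in the top block. -/
def domTest (W : ℕ) : Prog :=
  unroll W fun t =>
    .seq (.assign 8 (.cell 2 (.add (.cell 5 (.var 11)) (.lit t))))
    (.seq (.assign 9 (.lit 0))
    (.seq (.assign 6 (.cell 4 (.var 11)))
    (.seq (domLoop W)
    (.cond (.var 9) .skip
      (.cond (.var 8) (.cond (neqE (.var 8) (.var 7)) (.assign 10 (.lit 1)) .skip) .skip)))))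

theorem domTest_spec {W : ℕ} (hW : 0 < W) : ∃ c, ∀ (F : List (ℕ → ℕ)) (e : ℕ → ℕ) (s : State),
    Blk W (s.arr 2) (s.arr 4 (s.var 11)) F → s.var 16 = s.arr 4 (s.var 11) + W * F.length →
    (∀ t < W, s.arr 2 (s.arr 5 (s.var 11) + t) = e t) → s.var 10 = 0 →
    ∃ s', Does (domTest W) s s' (c * (F.length + 1)) ∧
      (s'.var 10 = 0 ↔ ¬ Dominated W F (s.var 7) e) ∧
      (∀ v, v ≠ 6 → v ≠ 8 → v ≠ 9 → v ≠ 10 → s'.var v = s.var v) ∧ s'.arr = s.arr := by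
  obtain ⟨c, hc⟩ := domLoop_spec hW
  set tail : Prog := .cond (.var 9) .skip
      (.cond (.var 8) (.cond (neqE (.var 8) (.var 7)) (.assign 10 (.lit 1)) .skip) .skip) with htail
  have htl : tail.LoopFree := by simp [htail, Prog.LoopFree]
  refine ⟨W * (20 + c + tail.bound) + 1, fun F e s hF h16 he h10 => ?_⟩
  obtain ⟨s', hd, hi, hv, ha⟩ := unroll_does (n := W) (c := 20 + c * (F.length + 1) + tail.bound)
    (P := fun t =>
    .seq (.assign 8 (.cell 2 (.add (.cell 5 (.var 11)) (.lit t))))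
    (.seq (.assign 9 (.lit 0))
    (.seq (.assign 6 (.cell 4 (.var 11)))
    (.seq (domLoop W) tail))))
    (fun n s' => (s'.var 10 = 0 ↔ ¬ ∃ t < n, e t ≠ 0 ∧ e t ≠ s.var 7 ∧
        ∀ r ∈ F, Mem W (s.var 7) r → Mem W (e t) r) ∧
      (∀ v, v ≠ 6 → v ≠ 8 → v ≠ 9 → v ≠ 10 → s'.var v = s.var v) ∧ s'.arr = s.arr)
    (by
      rintro t ht s₀ ⟨h10, hv, ha⟩
      have h11 : s₀.var 11 = s.var 11 := hv 11 (by simp) (by simp) (by simp) (by simp)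
      have h7 : s₀.var 7 = s.var 7 := hv 7 (by simp) (by simp) (by simp) (by simp)
      have h16' : s₀.var 16 = s.var 16 := hv 16 (by simp) (by simp) (by simp) (by simp)
      set pre : Prog := .seq (.assign 8 (.cell 2 (.add (.cell 5 (.var 11)) (.lit t))))
        (.seq (.assign 9 (.lit 0)) (.assign 6 (.cell 4 (.var 11)))) with hpre
      set s₁ := pre.run s₀ with hs₁
      simp only [hpre, Prog.run] at hs₁
      obtain ⟨s₂, hd₂, h9₂, hv₂, ha₂⟩ := hc F s₁ (by simpa [hs₁, Expr.eval, ha, h11] using hF)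
        (by simp [hs₁, Expr.eval, ha, h11, h16', h16])
      have hy : s₁.var 8 = e t := by simp [hs₁, Expr.eval, ha, h11, he t ht]
      have hx : s₁.var 7 = s.var 7 := by simp [hs₁, h7]
      have hz : s₁.var 9 = 0 := by simp [hs₁, Expr.eval]
      have ht8 : s₂.var 8 = e t := by rw [hv₂ 8 (by simp) (by simp), hy]
      have ht7 : s₂.var 7 = s.var 7 := by rw [hv₂ 7 (by simp) (by simp), hx]
      have ht10 : s₂.var 10 = s₀.var 10 := by rw [hv₂ 10 (by simp) (by simp)]; simp [hs₁]
      have hd₃ := htl.does s₂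
      refine ⟨tail.run s₂, ?_, ?_, ?_, ?_⟩
      · have a1 := (show Prog.LoopFree (.assign 8 (.cell 2 (.add (.cell 5 (.var 11)) (.lit t))))
          from trivial).does s₀
        have a2 := fun u => (show Prog.LoopFree (.assign 9 (.lit 0)) from trivial).does u
        have a3 := fun u => (show Prog.LoopFree (.assign 6 (.cell 4 (.var 11))) from trivial).does u
        refine (a1.seq ((a2 _).seq ((a3 _).seq (hd₂.seq hd₃)))).mono ?_
        simp only [Prog.bound, Expr.cost]; omega
      · rw [hx, hy] at h9₂
        simp only [hz, true_and] at h9₂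
        have hex : (∃ t' < t + 1, e t' ≠ 0 ∧ e t' ≠ s.var 7 ∧
            ∀ r ∈ F, Mem W (s.var 7) r → Mem W (e t') r) ↔
            (∃ t' < t, e t' ≠ 0 ∧ e t' ≠ s.var 7 ∧
            ∀ r ∈ F, Mem W (s.var 7) r → Mem W (e t') r) ∨ (e t ≠ 0 ∧ e t ≠ s.var 7 ∧
            ∀ r ∈ F, Mem W (s.var 7) r → Mem W (e t) r) := by
          simp only [Nat.lt_succ_iff_lt_or_eq, or_and_right, exists_or, exists_eq_left]
        rw [hex, not_or, ← h10, ← h9₂]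
        simp only [htail, Prog.run, Expr.eval, neqE_eval_eq_zero, ht8, ht7]
        by_cases h9 : s₂.var 9 = 0 <;> by_cases h8 : e t = 0 <;> by_cases h87 : e t = s.var 7 <;>
          simp [h9, h8, h87, ht10]
      · intro v h6 h8 h9 h10
        have : (tail.run s₂).var v = s₂.var v := by
          simp only [htail, Prog.run]; split_ifs <;> simp [h10]
        rw [this, hv₂ v h6 h9, ← hv v h6 h8 h9 h10]
        simp [hs₁, h6, h8, h9]
      · have : (tail.run s₂).arr = s₂.arr := by
          simp only [htail, Prog.run]; split_ifs <;> simp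
        rw [this, ha₂, ← ha]; simp [hs₁])
    (s := s) ⟨by simp [h10], fun _ _ _ _ _ => rfl, rfl⟩
  refine ⟨s', hd.mono ?_, hi, hv, ha⟩
  nlinarith [Nat.zero_le (W * 20 * F.length), Nat.zero_le (W * tail.bound * F.length)]

/-- Delete the entry `7` from the row at the address `6`. -/
def delProg (n : ℕ) : Prog :=
  unroll n fun t => .cond (neqE (.cell 2 (.add (.var 6) (.lit t))) (.var 7)) .skip
    (.store 2 (.add (.var 6) (.lit t)) (.lit 0))

theorem delProg_run (n : ℕ) (s : State) : ((delProg n).run s).var = s.var ∧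
    ∀ a i, ((delProg n).run s).arr a i =
      if a = 2 ∧ s.var 6 ≤ i ∧ i < s.var 6 + n ∧ s.arr 2 i = s.var 7 then 0 else s.arr a i := by
  induction n with
  | zero => exact ⟨rfl, fun a i => (if_neg (by omega)).symm⟩
  | succ n ih =>
    obtain ⟨hv, ha⟩ := ih
    have hrun : (delProg (n + 1)).run s =
      if ((delProg n).run s).arr 2 (s.var 6 + n) = s.var 7 then
        ((delProg n).run s).setCell 2 (s.var 6 + n) 0 else (delProg n).run s := by
      show Prog.run _ ((delProg n).run s) = _
      simp only [Prog.run, neqE_eval_eq_zero, Expr.eval, hv]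
    have hn : ((delProg n).run s).arr 2 (s.var 6 + n) = s.arr 2 (s.var 6 + n) := by
      rw [ha, if_neg (by omega)]
    rw [hrun, hn]
    constructor
    · split_ifs <;> simp [hv]
    · intro a i
      by_cases h7 : s.arr 2 (s.var 6 + n) = s.var 7
      · rw [if_pos h7, setCell_arr, ha]
        by_cases hi : a = 2 ∧ i = s.var 6 + n
        · rw [if_pos hi, if_pos ⟨hi.1, by omega, by omega, by rw [hi.2, h7]⟩]
        · rw [if_neg hi]
          refine if_congr ?_ rfl rfl
          grind
      · rw [if_neg h7, ha]
        refine if_congr ?_ rfl rfl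
        constructor
        · grind
        · rintro ⟨h1, h2, h3, h4⟩
          refine ⟨h1, h2, ?_, h4⟩
          by_contra h
          have : i = s.var 6 + n := by omega
          exact h7 (this ▸ h4)

/-- Copy the row at the address `6` to the address `17`. -/
def copyProg (n : ℕ) : Prog :=
  unroll n fun t => .store 2 (.add (.var 17) (.lit t)) (.cell 2 (.add (.var 6) (.lit t)))

theorem copyProg_run (n : ℕ) (s : State) (h : s.var 6 + n ≤ s.var 17) :
    ((copyProg n).run s).var = s.var ∧
    ∀ a i, ((copyProg n).run s).arr a i =
      if a = 2 ∧ s.var 17 ≤ i ∧ i < s.var 17 + n then s.arr 2 (s.var 6 + (i - s.var 17))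
      else s.arr a i := by
  induction n with
  | zero => exact ⟨rfl, fun a i => (if_neg (by omega)).symm⟩
  | succ n ih =>
    obtain ⟨hv, ha⟩ := ih (by omega)
    have hrun : (copyProg (n + 1)).run s =
        ((copyProg n).run s).setCell 2 (s.var 17 + n) (s.arr 2 (s.var 6 + n)) := by
      show Prog.run _ ((copyProg n).run s) = _
      simp only [Prog.run, Expr.eval, hv]
      rw [ha, if_neg (by omega)]
    rw [hrun]
    refine ⟨hv, fun a i => ?_⟩
    rw [setCell_arr, ha]
    by_cases hi : a = 2 ∧ i = s.var 17 + n
    · rw [if_pos hi, if_pos ⟨hi.1, by omega, by omega⟩, hi.2]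
      congr 1; omega
    · rw [if_neg hi]
      refine if_congr ?_ rfl rfl
      grind

/-- Go through the rows from the address `6` up to the address `16`. Delete the entry `7` from the
rows that have it, and copy the others to the address `17`. -/
def copyDel (W : ℕ) : Prog :=
  .loop (.sub (.var 16) (.var 6))
    (.seq (.cond (countE W (.var 6) (.var 7)) (delProg W)
        (.seq (copyProg W) (.assign 17 (.add (.var 17) (.lit W)))))
      (.assign 6 (.add (.var 6) (.lit W))))

/-- One pass prepares both alternatives: the block in place becomes the instance without `x`, and
the rows avoiding `x` form the block of a child. The target starts at or beyond the end of the
block, so no unread row is overwritten. -/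
theorem copyDel_spec {W : ℕ} (hW : 0 < W) : ∃ c, ∀ (F : List (ℕ → ℕ)) (s : State),
    Blk W (s.arr 2) (s.var 6) F → s.var 16 = s.var 6 + W * F.length → s.var 16 ≤ s.var 17 →
    ∃ s', Does (copyDel W) s s' (c * (F.length + 1)) ∧
      Blk W (s'.arr 2) (s.var 6) (del (s.var 7) F) ∧
      Blk W (s'.arr 2) (s.var 17) (drop W (s.var 7) F) ∧
      s'.var 17 = s.var 17 + W * (drop W (s.var 7) F).length ∧
      (∀ i < s.var 17, i < s.var 6 ∨ s.var 16 ≤ i → s'.arr 2 i = s.arr 2 i) ∧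
      (∀ v, v ≠ 6 → v ≠ 17 → s'.var v = s.var v) ∧ (∀ a, a ≠ 2 → s'.arr a = s.arr a) := by
  unfold copyDel
  generalize hb : Prog.seq _ _ = body
  refine ⟨(Expr.sub (.var 16) (.var 6)).cost + 1 + body.bound, fun F => ?_⟩
  induction F with
  | nil =>
    intro s _ h16 _
    exact ⟨s, (Does.loop_done (by simp [Expr.eval, h16])).mono (by simp), trivial, trivial,
      by simp [drop], by simp, by simp, by simp⟩
  | cons r F ih =>
    intro s hF h16 h17
    have hbody : body.LoopFree := by
      subst hb
      refine ⟨⟨?_, ?_, trivial⟩, trivial⟩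
      · exact unroll_loopFree (fun _ => by exact ⟨trivial, trivial⟩) W
      · exact unroll_loopFree (fun _ => by exact trivial) W
    simp only [List.length_cons, Nat.mul_succ] at h16
    have hcnt : cnt W (fun t => s.arr 2 (s.var 6 + t)) (s.var 7) = cnt W r (s.var 7) :=
      cnt_congr hF.1
    have hne : (Expr.sub (.var 16) (.var 6)).eval s ≠ 0 := by simp [Expr.eval]; omega
    by_cases hm : Mem W (s.var 7) r
    · have hrun : body.run s = ((delProg W).run s).setVar 6 (s.var 6 + W) := by
        subst hb
        have : cnt W r (s.var 7) ≠ 0 := by rw [← cnt_pos] at hm; omega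
        simp [Prog.run, Expr.eval, hcnt, this, (delProg_run W s).1]
      obtain ⟨hv₁, ha₁⟩ := delProg_run W s
      have hsame : ∀ i, s.var 6 + W ≤ i ∨ i < s.var 6 →
          ((delProg W).run s).arr 2 i = s.arr 2 i := by
        intro i hi; rw [ha₁, if_neg (by omega)]
      obtain ⟨s', hd, h1, h2, h3, h4, h5, h6⟩ := ih (body.run s)
        (by simpa [hrun] using hF.2.congr fun i hi _ => hsame i (Or.inl hi))
        (by simp [hrun, hv₁, h16]; ring) (by simp [hrun, hv₁, h17])
      simp only [hrun, setVar_var, setVar_arr, hv₁, if_true] at h1 h2 h3 h4 h5 h6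
      simp only [show (7 : ℕ) ≠ 6 by simp, show (17 : ℕ) ≠ 6 by simp, show (16 : ℕ) ≠ 6 by simp,
        if_false] at h1 h2 h3 h4
      have hdrop : drop W (s.var 7) (r :: F) = drop W (s.var 7) F := by simp [drop, hm]
      rw [hdrop]
      refine ⟨s', (Does.loop_step hne (hbody.does s) hd).mono ?_, ⟨fun t ht => ?_, h1⟩, h2, h3,
        fun i hi hi' => ?_, fun v hv6 hv17 => ?_, fun a ha => ?_⟩
      · simp only [List.length_cons, Nat.mul_succ]; omega
      · rw [h4 _ (by omega) (by omega), ha₁, hF.1 t ht]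
        simp only [true_and, delRow]
        refine if_congr ?_ rfl rfl
        simp [ht]
      · rw [h4 i hi (by omega), hsame i (by omega)]
      · rw [h5 v hv6 hv17]; simp [hv6]
      · rw [h6 a ha]; funext i; rw [ha₁, if_neg (by tauto)]
    · obtain ⟨hv₁, ha₁⟩ := copyProg_run W s (by omega)
      have hrun : body.run s =
          (((copyProg W).run s).setVar 17 (s.var 17 + W)).setVar 6 (s.var 6 + W) := by
        subst hb
        have : cnt W r (s.var 7) = 0 := cnt_eq_zero.2 hm
        simp [Prog.run, Expr.eval, hcnt, this, hv₁]
      have hsame : ∀ i, i < s.var 17 → ((copyProg W).run s).arr 2 i = s.arr 2 i := by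
        intro i hi; rw [ha₁, if_neg (by omega)]
      obtain ⟨s', hd, h1, h2, h3, h4, h5, h6⟩ := ih (body.run s)
        (by simpa [hrun] using hF.2.congr fun i _ hi => hsame i (by omega))
        (by simp [hrun, hv₁, h16]; ring) (by simp [hrun, hv₁]; omega)
      simp only [hrun, setVar_var, setVar_arr, hv₁, if_true] at h1 h2 h3 h4 h5 h6
      simp only [show (7 : ℕ) ≠ 6 by simp, show (17 : ℕ) ≠ 6 by simp, show (16 : ℕ) ≠ 6 by simp,
        show (7 : ℕ) ≠ 17 by simp, show (16 : ℕ) ≠ 17 by simp, if_false] at h1 h2 h3 h4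
      have hdrop : drop W (s.var 7) (r :: F) = r :: drop W (s.var 7) F := by simp [drop, hm]
      rw [hdrop]
      refine ⟨s', (Does.loop_step hne (hbody.does s) hd).mono ?_, ⟨fun t ht => ?_, h1⟩,
        ⟨fun t ht => ?_, h2⟩, ?_, fun i hi hi' => ?_, fun v hv6 hv17 => ?_, fun a ha => ?_⟩
      · simp only [List.length_cons, Nat.mul_succ]; omega
      · rw [h4 _ (by omega) (by omega), hsame _ (by omega), hF.1 t ht, delRow,
          if_neg fun h => hm ⟨t, ht, h⟩]
      · rw [h4 _ (by omega) (by omega), ha₁, if_pos ⟨rfl, by omega, by omega⟩, ← hF.1 t ht]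
        congr 1; omega
      · rw [h3, List.length_cons]; ring
      · rw [h4 i (by omega) (by omega), hsame i (by omega)]
      · rw [h5 v hv6 hv17]; simp [hv6, hv17]
      · rw [h6 a ha]; funext i; rw [ha₁, if_neg (by tauto)]

/-- Store in variable `18` the address of a row from the address `6` on with two deleted entries,
if there is any. -/
def selectLoop (W : ℕ) : Prog :=
  .loop (.sub (.var 16) (.var 6))
    (.seq (.cond (.sub (countE W (.var 6) (.lit 0)) (.lit 1)) (.assign 18 (.var 6)) .skip)
      (.assign 6 (.add (.var 6) (.lit W))))

theorem selectLoop_spec {W : ℕ} (hW : 0 < W) : ∃ c, ∀ (F : List (ℕ → ℕ)) (s : State),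
    Blk W (s.arr 2) (s.var 6) F → s.var 16 = s.var 6 + W * F.length →
    ∃ s', Does (selectLoop W) s s' (c * (F.length + 1)) ∧
      (((∀ r ∈ F, cnt W r 0 ≤ 1) ∧ s'.var 18 = s.var 18) ∨
        ∃ (i : ℕ) (hi : i < F.length), 2 ≤ cnt W F[i] 0 ∧ s'.var 18 = s.var 6 + W * i) ∧
      (∀ v, v ≠ 6 → v ≠ 18 → s'.var v = s.var v) ∧ s'.arr = s.arr := by
  unfold selectLoop
  generalize hb : Prog.seq _ _ = body
  refine ⟨(Expr.sub (.var 16) (.var 6)).cost + 1 + body.bound, fun F => ?_⟩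
  induction F with
  | nil =>
    intro s _ h16
    refine ⟨s, (Does.loop_done ?_).mono (by simp), by simp, by simp, rfl⟩
    simp [Expr.eval, h16]
  | cons r F ih =>
    intro s hF h16
    have hbody : body.LoopFree := by subst hb; exact ⟨⟨trivial, trivial⟩, trivial⟩
    simp only [List.length_cons, Nat.mul_succ] at h16
    have hcnt : cnt W (fun t => s.arr 2 (s.var 6 + t)) 0 = cnt W r 0 := cnt_congr hF.1
    have hrun : body.run s =
        (if 2 ≤ cnt W r 0 then s.setVar 18 (s.var 6) else s).setVar 6 (s.var 6 + W) := by
      subst hb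
      simp only [Prog.run, Expr.eval, countE_eval, hcnt]
      split_ifs <;> first | omega | simp
    obtain ⟨s', hd, h18, hv, ha⟩ := ih (body.run s)
      (by rw [hrun]; split_ifs <;> simpa using hF.2)
      (by rw [hrun]; split_ifs <;> (simp [h16]; ring))
    refine ⟨s', (Does.loop_step (by simp [Expr.eval]; omega) (hbody.does s) hd).mono ?_, ?_, ?_, ?_⟩
    · simp only [List.length_cons, Nat.mul_succ]; omega
    · rcases h18 with ⟨h1, h2⟩ | ⟨i, hi, h1, h2⟩
      · by_cases h : 2 ≤ cnt W r 0
        · refine Or.inr ⟨0, by simp, by simpa using h, ?_⟩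
          rw [h2, hrun, if_pos h]; simp
        · refine Or.inl ⟨?_, ?_⟩
          · intro r' hr'
            rcases List.mem_cons.1 hr' with rfl | hr'
            · omega
            · exact h1 r' hr'
          · rw [h2, hrun, if_neg h]; simp
      · refine Or.inr ⟨i + 1, by simpa using hi, by simpa using h1, ?_⟩
        rw [h2, hrun, setVar_var, if_pos rfl]; ring
    · intro v h6 h18
      rw [hv v h6 h18, hrun]
      split_ifs <;> simp [h6, h18]
    · rw [ha, hrun]; split_ifs <;> simp

/-! ### The stack of frames and the single steps of the search -/

theorem Does.pre {p q : Prog} {s s' : State} {T : ℕ} (hp : p.LoopFree) (h : Does q (p.run s) s' T) :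
    Does (.seq p q) s s' (p.bound + T) :=
  (hp.does s).seq h

/-- Put the block between the addresses `16` and `17` on the stack. -/
def push : Prog :=
  .seq (.store 3 (.var 11) (.var 7))
  (.seq (.assign 11 (.add (.var 11) (.lit 1)))
  (.seq (.store 4 (.add (.var 11) (.lit 1)) (.var 17)) (.assign 12 (.lit 0))))

/-- One entry fewer is left to branch on. -/
def advance : Prog := .store 6 (.var 11) (.sub (.cell 6 (.var 11)) (.lit 1))

/-- Branch on the entry `7`. -/
def branch (W : ℕ) : Prog :=
  .seq (.seq (.assign 10 (.lit 0)) (.assign 16 (.cell 4 (.add (.var 11) (.lit 1)))))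
  (.seq (domTest W)
  (.seq (.seq (.assign 6 (.cell 4 (.var 11))) (.assign 17 (.var 16)))
  (.seq (copyDel W) (.seq advance (.cond (.var 10) .skip push)))))

/-- Branch on the next entry of the selected row of the top frame. -/
def next (W : ℕ) : Prog :=
  .cond (.cell 6 (.var 11))
    (.seq (.assign 7 (.cell 2 (.add (.cell 5 (.var 11)) (.sub (.lit W) (.cell 6 (.var 11))))))
      (.cond (.var 7) (branch W) advance))
    (.assign 11 (.sub (.var 11) (.lit 1)))

/-- Select the row to branch on in a new top frame. -/
def enter (W Δ : ℕ) : Prog :=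
  .seq (.seq (.assign 12 (.lit 1)) (.seq (.assign 6 (.cell 4 (.var 11)))
    (.assign 16 (.cell 4 (.add (.var 11) (.lit 1))))))
  (.cond (.sub (.var 16) (.var 6))
    (.cond (.sub (.sub (.var 16) (.var 6)) (mulE (W * Δ) (.sub (.add (.var 13) (.lit 1)) (.var 11))))
      (.store 6 (.var 11) (.lit 0))
      (.seq (.assign 18 (.var 6))
      (.seq (selectLoop W) (.seq (.store 5 (.var 11) (.var 18)) (.store 6 (.var 11) (.lit W))))))
    (.seq (.assign 14 (.lit 1)) (.seq (.assign 15 (.var 11)) (.assign 11 (.lit 0)))))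

/-- One step of the search. -/
def searchStep (W Δ : ℕ) : Prog := .cond (.var 12) (next W) (enter W Δ)

/-- The frame `f` is on top of the stack and holds the rows `F`. -/
structure OnTop (W K : ℕ) (s : State) (f : ℕ) (F : List (ℕ → ℕ)) : Prop where
  top : s.var 11 = f
  size : s.var 13 = K
  notFound : s.var 14 = 0
  blk : Blk W (s.arr 2) (s.arr 4 f) F
  blkEnd : s.arr 4 (f + 1) = s.arr 4 f + W * F.length

/-- The top frame `f` is about to branch on the last `j` entries of its row `i`. -/
structure Branching (W K : ℕ) (s : State) (f : ℕ) (F : List (ℕ → ℕ)) (i j : ℕ) : Prop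
    extends OnTop W K s f F where
  phase : s.var 12 = 1
  row : s.arr 5 f = s.arr 4 f + W * i
  left : s.arr 6 f = j

/-- Nothing has changed below the frame `f`. -/
structure Same (f : ℕ) (s s' : State) : Prop where
  arr0 : s'.arr 0 = s.arr 0
  arr1 : s'.arr 1 = s.arr 1
  arr2 : ∀ i < s.arr 4 f, s'.arr 2 i = s.arr 2 i
  arr3 : ∀ g < f, s'.arr 3 g = s.arr 3 g
  arr4 : ∀ g ≤ f, s'.arr 4 g = s.arr 4 g
  arr5 : ∀ g < f, s'.arr 5 g = s.arr 5 g
  arr6 : ∀ g < f, s'.arr 6 g = s.arr 6 g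
  var0 : s'.var 0 = s.var 0
  var1 : s'.var 1 = s.var 1
  var13 : s'.var 13 = s.var 13
  var14 : s'.var 14 = s.var 14

theorem Same.trans {f : ℕ} {s s' s'' : State} (h : Same f s s') (h' : Same f s' s'') :
    Same f s s'' where
  arr0 := h'.arr0.trans h.arr0
  arr1 := h'.arr1.trans h.arr1
  arr2 i hi := (h'.arr2 i (by rwa [h.arr4 f le_rfl])).trans (h.arr2 i hi)
  arr3 g hg := (h'.arr3 g hg).trans (h.arr3 g hg)
  arr4 g hg := (h'.arr4 g hg).trans (h.arr4 g hg)
  arr5 g hg := (h'.arr5 g hg).trans (h.arr5 g hg)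
  arr6 g hg := (h'.arr6 g hg).trans (h.arr6 g hg)
  var0 := h'.var0.trans h.var0
  var1 := h'.var1.trans h.var1
  var13 := h'.var13.trans h.var13
  var14 := h'.var14.trans h.var14

theorem Same.pred {f : ℕ} {s s' : State} (h : Same (f + 1) s s') (hf : s.arr 4 f ≤ s.arr 4 (f + 1)) :
    Same f s s' where
  arr0 := h.arr0
  arr1 := h.arr1
  arr2 i hi := h.arr2 i (by omega)
  arr3 g hg := h.arr3 g (by omega)
  arr4 g hg := h.arr4 g (by omega)
  arr5 g hg := h.arr5 g (by omega)
  arr6 g hg := h.arr6 g (by omega)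
  var0 := h.var0
  var1 := h.var1
  var13 := h.var13
  var14 := h.var14

theorem advance_run {f : ℕ} {s : State} (hf : s.var 11 = f) :
    advance.run s = s.setCell 6 f (s.arr 6 f - 1) := by
  simp [advance, Prog.run, Expr.eval, hf]

theorem next_pop (W : ℕ) : ∃ c, ∀ (s : State), s.arr 6 (s.var 11) = 0 →
    Does (next W) s (s.setVar 11 (s.var 11 - 1)) c := by
  refine ⟨_, fun s h => Does.cond_false (by simpa [Expr.eval] using h)
    ((show Prog.LoopFree (.assign 11 (.sub (.var 11) (.lit 1))) from trivial).does s)⟩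

theorem next_zero (W : ℕ) : ∃ c, ∀ (K : ℕ) (F : List (ℕ → ℕ)) (s : State) (f i j : ℕ)
    (hi : i < F.length), j + 1 ≤ W → Branching W K s f F i (j + 1) → F[i] (W - (j + 1)) = 0 →
    ∃ s', Does (next W) s s' c ∧ Same f s s' ∧ Branching W K s' f F i j := by
  refine ⟨(Expr.cell 6 (.var 11)).cost + 1 +
    ((Prog.assign 7 (.cell 2 (.add (.cell 5 (.var 11)) (.sub (.lit W) (.cell 6 (.var 11)))))).bound +
    ((Expr.var 7).cost + 1 + advance.bound)), fun K F s f i j hi hj h hx => ?_⟩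
  have hx' : (Expr.cell 2 (.add (.cell 5 (.var 11)) (.sub (.lit W) (.cell 6 (.var 11))))).eval s
      = 0 := by
    simp only [Expr.eval, h.top, h.row, h.left]
    rw [h.blk.get hi (by omega), hx]
  refine ⟨_, Does.cond_true (by simp [Expr.eval, h.top, h.left]) (Does.pre trivial
    (Does.cond_false ?_ ((show advance.LoopFree from trivial).does _))), ?_⟩
  · simpa [Prog.run, Expr.eval] using hx'
  rw [advance_run (f := f) (by simp [Prog.run, h.top])]
  constructor
  · constructor <;> try (simp [Prog.run]; done)
    intro g hg; simp [Prog.run, hg.ne]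
  · refine ⟨⟨?_, ?_, ?_, ?_, ?_⟩, ?_, ?_, ?_⟩
    · simp [Prog.run, h.top]
    · simp [Prog.run, h.size]
    · simp [Prog.run, h.notFound]
    · exact h.blk.congr (by simp [Prog.run])
    · simp [Prog.run, h.blkEnd]
    · simp [Prog.run, h.phase]
    · simp [Prog.run, h.row]
    · simp [Prog.run, h.left]

/-- When a child is opened, the last four conjuncts record what frame `f` must retain so that it can
be resumed after the child fails. -/
theorem next_branch {W : ℕ} (hW : 0 < W) : ∃ c, ∀ (K : ℕ) (F : List (ℕ → ℕ)) (s : State)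
    (f i j x : ℕ) (hi : i < F.length), j + 1 ≤ W → Branching W K s f F i (j + 1) →
    F[i] (W - (j + 1)) = x → x ≠ 0 →
    ∃ s', Does (next W) s s' (c * (F.length + 1)) ∧ Same f s s' ∧
      ((Dominated W F x F[i] ∧ Branching W K s' f (del x F) i j) ∨
      (¬ Dominated W F x F[i] ∧ OnTop W K s' (f + 1) (drop W x F) ∧ s'.var 12 = 0 ∧
        s'.arr 3 f = x ∧ Blk W (s'.arr 2) (s'.arr 4 f) (del x F) ∧
        s'.arr 4 (f + 1) = s'.arr 4 f + W * F.length ∧ s'.arr 5 f = s'.arr 4 f + W * i ∧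
        s'.arr 6 f = j)) := by
  obtain ⟨c₁, hdom⟩ := domTest_spec hW
  obtain ⟨c₂, hcopy⟩ := copyDel_spec hW
  set p₀ : Prog := .assign 7 (.cell 2 (.add (.cell 5 (.var 11)) (.sub (.lit W) (.cell 6 (.var 11)))))
    with hp₀
  set p₁ : Prog := .seq (.assign 10 (.lit 0)) (.assign 16 (.cell 4 (.add (.var 11) (.lit 1))))
    with hp₁
  set p₂ : Prog := .seq (.assign 6 (.cell 4 (.var 11))) (.assign 17 (.var 16)) with hp₂
  set p₃ : Prog := .seq advance (.cond (.var 10) .skip push) with hp₃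
  have hf₀ : p₀.LoopFree := trivial
  have hf₁ : p₁.LoopFree := ⟨trivial, trivial⟩
  have hf₂ : p₂.LoopFree := ⟨trivial, trivial⟩
  have hf₃ : p₃.LoopFree := by simp [hp₃, Prog.LoopFree, advance, push]
  refine ⟨(Expr.cell 6 (.var 11)).cost + (Expr.var 7).cost + 2 +
    p₀.bound + p₁.bound + p₂.bound + p₃.bound + c₁ + c₂, fun K F s f i j x hi hj h hx hx0 => ?_⟩
  have h0 : p₀.run s = s.setVar 7 x := by
    simp only [hp₀, Prog.run, Expr.eval, h.top, h.row, h.left]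
    rw [h.blk.get hi (by omega), hx]
  set s₁ := p₁.run (p₀.run s) with hs₁
  have hs₁' : s₁ = ((s.setVar 7 x).setVar 10 0).setVar 16 (s.arr 4 f + W * F.length) := by
    rw [hs₁, h0]
    simp [hp₁, Prog.run, Expr.eval, h.top, h.blkEnd]
  obtain ⟨s₂, hd₂, hD, hv₂, ha₂⟩ := hdom F F[i] s₁ (by simpa [hs₁', h.top] using h.blk)
    (by simp [hs₁', h.top]) (by
      intro t ht
      simp only [hs₁', setVar_arr, setVar_var]
      simp only [show (11 : ℕ) ≠ 16 by simp, show (11 : ℕ) ≠ 10 by simp, show (11 : ℕ) ≠ 7 by simp,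
        if_false, h.top, h.row]
      exact h.blk.get hi ht) (by simp [hs₁'])
  have hs₃ : p₂.run s₂ = (s₂.setVar 6 (s.arr 4 f)).setVar 17 (s.arr 4 f + W * F.length) := by
    simp [hp₂, Prog.run, Expr.eval, hv₂, ha₂, hs₁', h.top]
  obtain ⟨s₄, hd₄, hb, hb', h17, h2, hv₄, ha₄⟩ := hcopy F (p₂.run s₂)
    (by simpa [hs₃, ha₂, hs₁'] using h.blk) (by simp [hs₃, hv₂, hs₁'])
    (by simp [hs₃, hv₂, hs₁'])
  have hlen : (del x F).length = F.length := by simp [del]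
  have e7 : (p₂.run s₂).var 7 = x := by simp [hs₃, hv₂, hs₁']
  have e6 : (p₂.run s₂).var 6 = s.arr 4 f := by simp [hs₃]
  have e17 : (p₂.run s₂).var 17 = s.arr 4 f + W * F.length := by simp [hs₃]
  have e16 : (p₂.run s₂).var 16 = s.arr 4 f + W * F.length := by simp [hs₃, hv₂, hs₁']
  have ea : (p₂.run s₂).arr = s.arr := by simp [hs₃, ha₂, hs₁']
  rw [e7] at hb hb' h17
  rw [e6] at hb
  rw [e17] at hb' h17
  rw [e17, e16, e6, ea] at h2
  rw [ea] at ha₄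
  have hv : ∀ v, v ≠ 6 → v ≠ 7 → v ≠ 8 → v ≠ 9 → v ≠ 10 → v ≠ 16 → v ≠ 17 → s₄.var v = s.var v := by
    intro v h6 h7 h8 h9 h10 h16 h17
    rw [hv₄ v h6 h17, hs₃]
    simp [h6, h17, hv₂ v h6 h8 h9 h10, hs₁', h16, h10, h7]
  have e10 : s₄.var 10 = s₂.var 10 := by rw [hv₄ 10 (by simp) (by simp), hs₃]; simp
  have e7' : s₄.var 7 = x := by rw [hv₄ 7 (by simp) (by simp), e7]
  have e11 : s₄.var 11 = f := by rw [hv 11] <;> simp [h.top]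
  have hdoes : Does (next W) s (p₃.run s₄) (((Expr.cell 6 (.var 11)).cost + (Expr.var 7).cost + 2 +
      p₀.bound + p₁.bound + p₂.bound + p₃.bound + c₁ + c₂) * (F.length + 1)) := by
    refine Does.mono (Does.cond_true (by simp [Expr.eval, h.top, h.left]) (Does.pre hf₀
      (Does.cond_true ?_ (Does.pre hf₁ (hd₂.seq (Does.pre hf₂ (hd₄.seq (hf₃.does _)))))))) ?_
    · rw [h0]; simpa [Expr.eval] using hx0
    · nlinarith [Nat.zero_le (((Expr.cell 6 (.var 11)).cost + (Expr.var 7).cost + 2 +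
        p₀.bound + p₁.bound + p₂.bound + p₃.bound) * F.length)]
  refine ⟨_, hdoes, ?_⟩
  have hadv : advance.run s₄ = s₄.setCell 6 f j := by
    rw [advance_run e11, ha₄ 6 (by simp), h.left]; simp
  have hs7 : s₁.var 7 = x := by simp [hs₁']
  rw [hs7, ← e10] at hD
  by_cases hdd : Dominated W F x F[i]
  · have h10 : s₄.var 10 ≠ 0 := fun h' => hD.1 h' hdd
    have hrun : p₃.run s₄ = s₄.setCell 6 f j := by
      simp [hp₃, Prog.run, hadv, Expr.eval, h10]
    rw [hrun]
    refine ⟨?_, Or.inl ⟨hdd, ⟨?_, ?_, ?_, ?_, ?_⟩, ?_, ?_, ?_⟩⟩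
    · constructor <;> try (simp [ha₄, hv]; done)
      · intro i hi; simp [h2 i (by omega) (by omega)]
      · intro g hg; simp [ha₄, hg.ne]
    · simp [e11]
    · simp [hv, h.size]
    · simp [hv, h.notFound]
    · simp only [setCell_arr, ha₄ 4 (by simp)]
      simpa using hb
    · simp [ha₄, h.blkEnd, hlen]
    · simp [hv, h.phase]
    · simp [ha₄, h.row]
    · simp
  · have h10 : s₄.var 10 = 0 := hD.2 hdd
    have hrun : p₃.run s₄ = ((((s₄.setCell 6 f j).setCell 3 f x).setVar 11 (f + 1)).setCell 4
        (f + 1 + 1) (s₄.var 17)).setVar 12 0 := by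
      simp [hp₃, Prog.run, hadv, Expr.eval, h10, push, e11, e7']
    rw [hrun]
    have e4 : f ≠ f + 1 + 1 := by omega
    refine ⟨?_, Or.inr ⟨hdd, ⟨?_, ?_, ?_, ?_, ?_⟩, ?_, ?_, ?_, ?_, ?_, ?_⟩⟩
    · constructor <;> try (simp [ha₄, hv]; done)
      · intro i hi; simp [h2 i (by omega) (by omega)]
      · intro g hg; simp [ha₄, hg.ne]
      · intro g hg; simp [ha₄, show g ≠ f + 1 + 1 by omega]
      · intro g hg; simp [ha₄, hg.ne]
    · simp
    · simp [hv, h.size]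
    · simp [hv, h.notFound]
    · simp only [setCell_arr, setVar_arr, ha₄ 4 (by simp)]
      simpa [h.blkEnd] using hb'
    · simp [ha₄, h.blkEnd, h17]
    · simp
    · simp
    · simp only [setCell_arr, setVar_arr, ha₄ 4 (by simp)]
      simpa [e4] using hb
    · simp [ha₄, h.blkEnd, e4]
    · simp [ha₄, h.row, e4]
    · simp

/-- A frame with too many rows must be rejected in constant time, whatever its length: with no
entries left to branch on, it is popped by the next step. Only a frame that branches pays for a scan
of its rows. -/
theorem enter_spec {W : ℕ} (hW : 0 < W) (Δ : ℕ) : ∃ c, ∀ (K : ℕ) (F : List (ℕ → ℕ)) (s : State)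
    (f : ℕ),
    OnTop W K s f F →
    (F = [] → ∃ s', Does (enter W Δ) s s' c ∧ s'.var 11 = 0 ∧ s'.var 14 = 1 ∧ s'.var 15 = f ∧
      s'.arr = s.arr ∧ s'.var 0 = s.var 0 ∧ s'.var 1 = s.var 1 ∧ s'.var 13 = s.var 13) ∧
    (F ≠ [] → Δ * (K + 1 - f) < F.length → ∃ s', Does (enter W Δ) s s' c ∧ Same f s s' ∧
      s'.var 11 = f ∧ s'.var 12 = 1 ∧ s'.arr 6 f = 0) ∧
    (F ≠ [] → F.length ≤ Δ * (K + 1 - f) → ∃ s', Does (enter W Δ) s s' (c * (F.length + 1)) ∧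
      Same f s s' ∧ ∃ (i : ℕ) (hi : i < F.length), Branching W K s' f F i W ∧
      ((∃ r ∈ F, 2 ≤ cnt W r 0) → 2 ≤ cnt W F[i] 0)) := by
  obtain ⟨c₁, hsel⟩ := selectLoop_spec hW
  unfold enter
  set p₀ : Prog := .seq (.assign 12 (.lit 1)) (.seq (.assign 6 (.cell 4 (.var 11)))
    (.assign 16 (.cell 4 (.add (.var 11) (.lit 1))))) with hp₀
  set e₁ : Expr := .sub (.var 16) (.var 6) with he₁
  set e₂ : Expr := .sub (.sub (.var 16) (.var 6))
    (mulE (W * Δ) (.sub (.add (.var 13) (.lit 1)) (.var 11))) with he₂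
  set p₁ : Prog := .seq (.store 5 (.var 11) (.var 18)) (.store 6 (.var 11) (.lit W)) with hp₁
  set p₂ : Prog := .seq (.assign 14 (.lit 1)) (.seq (.assign 15 (.var 11)) (.assign 11 (.lit 0)))
    with hp₂
  have hf₀ : p₀.LoopFree := by simp [hp₀, Prog.LoopFree]
  have hf₁ : p₁.LoopFree := by simp [hp₁, Prog.LoopFree]
  have hf₂ : p₂.LoopFree := by simp [hp₂, Prog.LoopFree]
  refine ⟨p₀.bound + e₁.cost + e₂.cost + p₁.bound + p₂.bound + 40 + c₁, fun K F s f h => ?_⟩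
  have h0 : p₀.run s = ((s.setVar 12 1).setVar 6 (s.arr 4 f)).setVar 16
      (s.arr 4 f + W * F.length) := by
    simp [hp₀, Prog.run, Expr.eval, h.top, h.blkEnd]
  have hv1 : e₁.eval (p₀.run s) = W * F.length := by simp [he₁, h0, Expr.eval]
  -- Frames are numbered from 1, so frame `f` has `K + 1 - f` elements left to select. Block sizes
  -- in memory carry a factor `W`.
  have hv2 : e₂.eval (p₀.run s) = W * F.length - W * (Δ * (K + 1 - f)) := by
    simp [he₂, h0, Expr.eval, h.size, h.top, mul_assoc]
  refine ⟨?_, ?_, ?_⟩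
  · rintro rfl
    refine ⟨p₂.run (p₀.run s), (Does.pre hf₀ (Does.cond_false (by simp [hv1])
      (hf₂.does _))).mono (by omega), ?_⟩
    simp [h0, hp₂, Prog.run, Expr.eval, h.top]
  · intro hF hlen
    have hpos : 0 < F.length := List.length_pos_iff.2 hF
    refine ⟨(p₀.run s).setCell 6 f 0, (Does.pre hf₀ (Does.cond_true (by rw [hv1]; positivity)
      (Does.cond_true ?_ (T := 20) ?_))).mono (by omega), ?_, ?_, ?_, ?_⟩
    · rw [hv2]
      have := Nat.mul_lt_mul_of_pos_left hlen hW
      omega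
    · have := (show Prog.LoopFree (.store 6 (.var 11) (.lit 0)) from trivial).does (p₀.run s)
      simp only [Prog.run, Expr.eval, show (p₀.run s).var 11 = f by simp [h0, h.top]] at this
      exact this.mono (by simp [Prog.bound, Expr.cost])
    · constructor <;> try (simp [h0]; done)
      intro g hg; simp [h0, hg.ne]
    · simp [h0, h.top]
    · simp [h0]
    · simp
  · intro hF hlen
    have hpos : 0 < F.length := List.length_pos_iff.2 hF
    set s₁ := (p₀.run s).setVar 18 (s.arr 4 f) with hs₁
    obtain ⟨s₂, hd, h18, hv, ha⟩ := hsel F s₁ (by simpa [hs₁, h0] using h.blk) (by simp [hs₁, h0])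
    have ha' : s₂.arr = s.arr := by simp [ha, hs₁, h0]
    have hrun : p₁.run s₂ = (s₂.setCell 5 f (s₂.var 18)).setCell 6 f W := by
      simp [hp₁, Prog.run, Expr.eval, hv, hs₁, h0, h.top]
    have hi : ∃ (i : ℕ) (hi : i < F.length), s₂.var 18 = s.arr 4 f + W * i ∧
        ((∃ r ∈ F, 2 ≤ cnt W r 0) → 2 ≤ cnt W F[i] 0) := by
      rcases h18 with ⟨h1, h2⟩ | ⟨i, hi, h1, h2⟩
      · refine ⟨0, hpos, by simp [h2, hs₁], ?_⟩
        rintro ⟨r, hr, h2⟩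
        have := h1 r hr
        omega
      · exact ⟨i, hi, by simp [h2, hs₁, h0], fun _ => h1⟩
    obtain ⟨i, hi, h18, hsm⟩ := hi
    refine ⟨p₁.run s₂, (Does.pre hf₀ (Does.cond_true (by rw [hv1]; positivity)
      (Does.cond_false ?_ (Does.pre (show Prog.LoopFree (.assign 18 (.var 6)) from trivial)
        (Does.seq (s' := s₂) ?_ (hf₁.does _)))))).mono
      (T := p₀.bound + (e₁.cost + 1 + (e₂.cost + 1 + ((Prog.assign 18 (.var 6)).bound +
        (c₁ * (F.length + 1) + p₁.bound))))) ?_, ?_, i, hi,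
      ⟨⟨?_, ?_, ?_, ?_, ?_⟩, ?_, ?_, ?_⟩, hsm⟩
    · rw [hv2]
      have := Nat.mul_le_mul_left W hlen
      omega
    · convert hd using 1
      simp [hs₁, Prog.run, Expr.eval, h0]
    · simp only [Prog.bound, Expr.cost]
      nlinarith [Nat.zero_le ((p₀.bound + e₁.cost + e₂.cost + p₁.bound + p₂.bound + 40) * F.length)]
    · rw [hrun]
      constructor <;> try (simp [hv, ha', hs₁, h0]; done)
      · intro g hg; simp [ha', hg.ne]
      · intro g hg; simp [ha', hg.ne]
    · simp [hrun, hv, hs₁, h0, h.top]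
    · simp [hrun, hv, hs₁, h0, h.size]
    · simp [hrun, hv, hs₁, h0, h.notFound]
    · simp only [hrun, setCell_arr, ha']
      simpa [ha'] using h.blk
    · simp [hrun, ha', h.blkEnd]
    · simp [hrun, hv, hs₁, h0]
    · simp [hrun, ha', h18]
    · simp [hrun]

/-! ### Correctness and cost of branching -/

/-- Search until the stack is empty or a solution is found. -/
def search (W Δ : ℕ) : Prog := .loop (.var 11) (searchStep W Δ)

/-- The frame `f` has been removed from the stack. -/
structure Failed (f : ℕ) (s s' : State) : Prop extends Same f s s' where
  top : s'.var 11 + 1 = f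
  phase : s'.var 12 = 1

/-- The entries selected from the frame `f` on hit all rows of `F`. -/
structure Solved (W K f : ℕ) (F : List (ℕ → ℕ)) (s s' : State) : Prop where
  top : s'.var 11 = 0
  found : s'.var 14 = 1
  arr1 : s'.arr 1 = s.arr 1
  var0 : s'.var 0 = s.var 0
  arr3 : ∀ g < f, s'.arr 3 g = s.arr 3 g
  ge : f ≤ s'.var 15
  le : s'.var 15 ≤ K + 1
  hits : ∀ r ∈ F, ∃ g, f ≤ g ∧ g < s'.var 15 ∧ s'.arr 3 g ≠ 0 ∧ Mem W (s'.arr 3 g) r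

/-- The search from `s`, with the frame `f` on top and `k` entries to select, ended in `s'`. -/
def Outcome (W K f k : ℕ) (F : List (ℕ → ℕ)) (s s' : State) : Prop :=
  (Failed f s s' ∧ ∀ S, Hits W F S → k < S.card) ∨ Solved W K f F s s'

theorem Outcome.of_same {W K f k : ℕ} {F : List (ℕ → ℕ)} {s s₁ s' : State} (h : Same f s s₁)
    (h' : Outcome W K f k F s₁ s') : Outcome W K f k F s s' := by
  rcases h' with ⟨h₁, hS⟩ | h₁
  · exact Or.inl ⟨⟨h.trans h₁.toSame, h₁.top, h₁.phase⟩, hS⟩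
  · exact Or.inr ⟨h₁.top, h₁.found, h₁.arr1.trans h.arr1, h₁.var0.trans h.var0,
      fun g hg => (h₁.arr3 g hg).trans (h.arr3 g hg), h₁.ge, h₁.le, h₁.hits⟩

/-- Deletion only shrinks rows, so whatever hits the shrunken rows hits the original ones. -/
theorem Solved.of_del {W K f x : ℕ} {F : List (ℕ → ℕ)} {s s' : State}
    (h : Solved W K f (del x F) s s') : Solved W K f F s s' := by
  refine ⟨h.top, h.found, h.arr1, h.var0, h.arr3, h.ge, h.le, fun r hr => ?_⟩
  obtain ⟨g, h1, h2, h3, h4⟩ := h.hits _ (List.mem_map_of_mem hr)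
  exact ⟨g, h1, h2, h3, ((mem_delRow h3).1 h4).2⟩

/-- The summand 4 pays for the loop test and the phase test. -/
theorem steps_next {W Δ c : ℕ} {s s' : State} (h11 : s.var 11 ≠ 0) (h12 : s.var 12 = 1)
    (h : Does (next W) s s' c) : Steps (.var 11) (searchStep W Δ) s s' (c + 4) := by
  have := Does.steps (e := .var 11) (p := searchStep W Δ) (by simpa [Expr.eval] using h11)
    (Does.cond_true (e := .var 12) (q := enter W Δ) (by simp [Expr.eval, h12]) h)
  exact this.mono (by simp only [Expr.cost]; push_cast; linarith)

theorem steps_enter {W Δ c : ℕ} {s s' : State} (h11 : s.var 11 ≠ 0) (h12 : s.var 12 = 0)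
    (h : Does (enter W Δ) s s' c) : Steps (.var 11) (searchStep W Δ) s s' (c + 4) := by
  have := Does.steps (e := .var 11) (p := searchStep W Δ) (by simpa [Expr.eval] using h11)
    (Does.cond_false (e := .var 12) (p := next W) (by simp [Expr.eval, h12]) h)
  exact this.mono (by simp only [Expr.cost]; push_cast; linarith)

/-- Induction on the number `j` of entries left in the selected row; the earlier entries are already
deleted. `A` is the cost of a child per unit of weight, supplied by the hypothesis on frame `f + 1`.
-/
theorem branch_spec {W : ℕ} (hW : 0 < W) (Δ : ℕ) {τ : ℝ} (hτ : 1 ≤ τ) : ∃ c : ℕ, ∀ (K k f : ℕ) (A : ℝ),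
    0 ≤ A → 1 ≤ f → f + (k + 1) = K + 1 →
    (∀ (F : List (ℕ → ℕ)) (s : State), Sparse W Δ F → OnTop W K s (f + 1) F → s.var 12 = 0 →
      ∃ s', Steps (.var 11) (searchStep W Δ) s s' (wt W τ F * A) ∧ Outcome W K (f + 1) k F s s') →
    ∀ j ≤ W, ∀ (F : List (ℕ → ℕ)) (s : State) (i : ℕ) (hi : i < F.length), Sparse W Δ F →
      Branching W K s f F i j → (∀ t < W - j, F[i] t = 0) →
      ∃ s', Steps (.var 11) (searchStep W Δ) s s'
          (c * (F.length + 1) * (j + 1) + childSum W τ j F F[i] * A) ∧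
        Outcome W K f (k + 1) F s s' := by
  obtain ⟨c₁, hpop⟩ := next_pop W
  obtain ⟨c₂, hzero⟩ := next_zero W
  obtain ⟨c₃, hbr⟩ := next_branch hW
  refine ⟨c₁ + c₂ + c₃ + 4, fun K k f A hA hf hk ih j => ?_⟩
  have hc₁ : (0 : ℝ) ≤ c₁ := c₁.cast_nonneg
  have hc₂ : (0 : ℝ) ≤ c₂ := c₂.cast_nonneg
  have hc₃ : (0 : ℝ) ≤ c₃ := c₃.cast_nonneg
  push_cast
  induction j with
  | zero =>
    intro _ F s i hi hF h hz
    have hl : (0 : ℝ) ≤ F.length := F.length.cast_nonneg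
    refine ⟨_, (steps_next (by rw [h.top]; omega) h.phase
      (hpop s (by rw [h.top, h.left]))).mono ?_, Or.inl ⟨⟨?_, ?_, ?_⟩, fun S hS => ?_⟩⟩
    · simp only [childSum]; push_cast; nlinarith
    · constructor <;> simp
    · simp [h.top]; omega
    · simp [h.phase]
    · obtain ⟨x, _, hx0, t, ht, hx⟩ := hS F[i] (List.getElem_mem hi)
      exact absurd ((hz t ht).symm.trans hx) hx0.symm
  | succ j ihj =>
    intro hj F s i hi hF h hz
    have hl : (0 : ℝ) ≤ F.length := F.length.cast_nonneg
    have hj0 : (0 : ℝ) ≤ j := j.cast_nonneg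
    have h11 : s.var 11 ≠ 0 := by rw [h.top]; omega
    by_cases hx : F[i] (W - (j + 1)) = 0
    · obtain ⟨s₁, hd, hsame, h₁⟩ := hzero K F s f i j hi hj h hx
      obtain ⟨s₂, hst, ho⟩ := ihj (by omega) F s₁ i hi hF h₁ (by
        intro t ht
        rcases (show t < W - (j + 1) ∨ t = W - (j + 1) by omega) with h' | rfl
        · exact hz t h'
        · exact hx)
      refine ⟨s₂, ((steps_next h11 h.phase hd).trans hst).mono ?_, ho.of_same hsame⟩
      simp only [childSum, hx, if_true]
      push_cast
      have : 0 ≤ (F.length : ℝ) * (c₁ + c₂ + c₃ + 4) := by positivity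
      linarith
    · obtain ⟨s₁, hd, hsame, h₁⟩ := hbr K F s f i j _ hi hj h rfl hx
      set x := F[i] (W - (j + 1)) with hxdef
      have hi' : i < (del x F).length := by simpa [del] using hi
      have hFi : (del x F)[i] = delRow x F[i] := by simp [del]
      have hlen : (del x F).length = F.length := by simp [del]
      have hz' : ∀ t < W - j, (del x F)[i] t = 0 := by
        intro t ht
        rw [hFi]
        rcases (show t < W - (j + 1) ∨ t = W - (j + 1) by omega) with h' | rfl
        · simp [delRow, hz t h']
        · simp [delRow, ← hxdef]
      simp only [childSum, if_neg hx, ← hxdef]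
      rcases h₁ with ⟨hdom, h₁⟩ | ⟨hdom, h₁, h12, h3, hb, h4, h5, h6⟩
      · obtain ⟨s₂, hst, ho⟩ := ihj (by omega) (del x F) s₁ i hi' hF.del h₁ hz'
        refine ⟨s₂, ((steps_next h11 h.phase hd).trans hst).mono ?_, Outcome.of_same hsame ?_⟩
        · rw [if_pos hdom, hlen, hFi]
          push_cast
          nlinarith
        · rcases ho with ⟨h', hS⟩ | h'
          · refine Or.inl ⟨h', fun S hSF => ?_⟩
            obtain ⟨t, _, hy0, hyx, hd⟩ := hdom
            obtain ⟨S', hS', hxS', hcard⟩ := hSF.of_dominated hy0 hyx hd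
            exact (hS S' (hS'.del hxS')).trans_le hcard
          · exact Or.inr h'.of_del
      · obtain ⟨s₂, hst, ho⟩ := ih _ s₁ hF.drop h₁ h12
        rcases ho with ⟨h', hS⟩ | h'
        -- The child has failed and been popped without touching the frame of its parent, which goes
        -- on with `x` deleted.
        · have hsame' : Same f s₁ s₂ := h'.toSame.pred (by rw [h4]; omega)
          have hbr₂ : Branching W K s₂ f (del x F) i j := by
            refine ⟨⟨?_, ?_, ?_, ?_, ?_⟩, h'.phase, ?_, ?_⟩
            · have := h'.top; omega
            · rw [h'.var13, h₁.size]
            · rw [h'.var14, h₁.notFound]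
            · rw [hsame'.arr4 f le_rfl]
              refine hb.congr fun a _ ha => h'.arr2 a ?_
              rw [h4]; rwa [hlen] at ha
            · rw [h'.arr4 (f + 1) le_rfl, hsame'.arr4 f le_rfl, h4, hlen]
            · rw [h'.arr5 f (by omega), hsame'.arr4 f le_rfl, h5]
            · rw [h'.arr6 f (by omega), h6]
          obtain ⟨s₃, hst₃, ho⟩ := ihj (by omega) (del x F) s₂ i hi' hF.del hbr₂ hz'
          refine ⟨s₃, (((steps_next h11 h.phase hd).trans hst).trans hst₃).mono ?_,
            Outcome.of_same (hsame.trans hsame') ?_⟩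
          · rw [if_neg hdom, hlen, hFi]
            push_cast
            nlinarith
          · rcases ho with ⟨h'', hS'⟩ | h''
            · refine Or.inl ⟨h'', fun S hSF => ?_⟩
              -- The failed child excludes small hitting sets with `x`; the failure on the later
              -- entries excludes those without.
              by_cases hxS : x ∈ S
              · by_contra hcard
                obtain ⟨h1, h2⟩ := hSF.drop hxS (k := k) (by omega)
                exact absurd (hS _ h1) (by omega)
              · exact hS' S (hSF.del hxS)
            · exact Or.inr h''.of_del
        · refine ⟨s₂, ((steps_next h11 h.phase hd).trans hst).mono ?_, Or.inr ⟨h'.top, h'.found,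
            h'.arr1.trans hsame.arr1, h'.var0.trans hsame.var0,
            fun g hg => (h'.arr3 g (by omega)).trans (hsame.arr3 g hg), by have := h'.ge; omega,
            h'.le, fun r hr => ?_⟩⟩
          · rw [if_neg hdom]
            have h1 := mul_nonneg (childSum_nonneg (W := W) hτ j (del x F) (delRow x F[i])) hA
            have h2 : 0 ≤ ((c₁ : ℝ) + c₂ + c₃ + 4) * (F.length + 1) * (j + 1) := by positivity
            push_cast
            nlinarith
          -- Rows with `x` are hit by the entry recorded at level `f`; all others were passed on to
          -- the child.
          · by_cases hxr : Mem W x r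
            · have e : s₂.arr 3 f = x := (h'.arr3 f (by omega)).trans h3
              exact ⟨f, le_rfl, h'.ge, by rwa [e], by rwa [e]⟩
            · obtain ⟨g, h1, h2⟩ := h'.hits r (mem_drop.2 ⟨hr, hxr⟩)
              exact ⟨g, by omega, h2⟩


/-! ### Summing the work over the search tree -/

/-- The accumulated overhead, relative to `β ^ k`, of the search for `k` entries. -/
noncomputable def overhead (c β : ℝ) (k : ℕ) : ℝ :=
  ∑ i ∈ Finset.range (k + 1), c * (i + 1) / β ^ i

theorem overhead_nonneg {c β : ℝ} (hc : 0 ≤ c) (hβ : 0 ≤ β) (k : ℕ) : 0 ≤ overhead c β k :=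
  Finset.sum_nonneg fun i _ => by positivity

/-- Thus `overhead c β k * β ^ k` obeys the recurrence `T (k + 1) = β * T k + c * (k + 2)` of the
search. -/
theorem overhead_succ_mul {c β : ℝ} (hβ : 0 < β) (k : ℕ) :
    overhead c β (k + 1) * β ^ (k + 1) =
      overhead c β k * β ^ k * β + c * ((k + 1 : ℕ) + 1) := by
  rw [overhead, Finset.sum_range_succ, ← overhead, add_mul, div_mul_cancel₀ _ (by positivity)]
  ring

theorem le_overhead_mul {c β : ℝ} (hc : 0 ≤ c) (hβ : 0 < β) (k : ℕ) :
    c * (k + 1) ≤ overhead c β k * β ^ k := by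
  rw [← div_le_iff₀ (by positivity)]
  exact Finset.single_le_sum (f := fun i : ℕ => c * (i + 1) / β ^ i)
    (fun i _ => by positivity) (Finset.self_mem_range_succ k)

/-- Deep in the tree budgets are small, so linear work per node costs only a constant factor: the
full series converges. -/
theorem overhead_bounded {c β : ℝ} (hc : 0 ≤ c) (hβ : 1 < β) : ∃ M, ∀ k, overhead c β k ≤ M := by
  have hr : ‖β⁻¹‖ < 1 := by
    rw [Real.norm_of_nonneg (by positivity)]
    exact inv_lt_one_of_one_lt₀ hβ
  have hs : Summable fun i : ℕ => c * (i + 1) / β ^ i := by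
    have h1 := summable_pow_mul_geometric_of_norm_lt_one 1 hr
    have h0 := summable_geometric_of_norm_lt_one hr
    refine ((h1.add h0).mul_left c).congr fun i => ?_
    rw [inv_pow]; field_simp
  exact ⟨_, fun k => hs.sum_le_tsum _ fun i _ => by positivity⟩

/-- Induction on the budget `k`. The factor `β` of the recurrence is the growth of weight from a
node to its children (`childSum_le`); the added term is the work at the node itself. -/
theorem search_spec {W : ℕ} (hW : 3 ≤ W) (Δ : ℕ) {β τ : ℝ} (hβ : β ^ 2 = (W - 2) * β + 1)
    (hβ1 : 1 < β) (hτ1 : 1 ≤ τ) (hτ : τ = β - W + 3) : ∃ c : ℝ, 0 ≤ c ∧ ∀ (K k f : ℕ)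
    (F : List (ℕ → ℕ)) (s : State), 1 ≤ f → f + k = K + 1 → Sparse W Δ F → OnTop W K s f F →
      s.var 12 = 0 →
      ∃ s', Steps (.var 11) (searchStep W Δ) s s' (wt W τ F * (overhead c β k * β ^ k)) ∧
        Outcome W K f k F s s' := by
  obtain ⟨c₀, hpop⟩ := next_pop W
  obtain ⟨c₁, henter⟩ := enter_spec (show 0 < W by omega) Δ
  obtain ⟨c₂, hbranch⟩ := branch_spec (show 0 < W by omega) Δ hτ1
  -- `c₀`, `c₁`, `c₂` come from popping, entering and branching, 8 from two rounds of tests; `Δ + 1`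
  -- converts numbers of rows into budgets.
  set c : ℝ := (c₀ + 8 + c₁ + c₂ * (W + 1)) * (Δ + 1) with hc
  have hc0 : 0 ≤ c := by positivity
  have hβ0 : 0 < β := by linarith
  refine ⟨c, hc0, fun K k => ?_⟩
  -- Nodes without children: no row is left, or more rows than the budget can hit. For `k = 0` every
  -- node is of this kind.
  have leaf : ∀ (k f : ℕ) (F : List (ℕ → ℕ)) (s : State), 1 ≤ f → f + k = K + 1 →
      Sparse W Δ F → OnTop W K s f F → s.var 12 = 0 → (F ≠ [] → Δ * k < F.length) →
      ∃ s', Steps (.var 11) (searchStep W Δ) s s' (wt W τ F * (overhead c β k * β ^ k)) ∧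
        Outcome W K f k F s s' := by
    intro k f F s hf hk hF h h12 hlen
    have h11 : s.var 11 ≠ 0 := by rw [h.top]; omega
    have hbound : (c₀ : ℝ) + 8 + c₁ ≤ wt W τ F * (overhead c β k * β ^ k) := by
      have h1 := le_overhead_mul hc0 hβ0 k
      have h2 : 0 ≤ c * k := by positivity
      have h3 := one_le_wt (W := W) hτ1 F
      have h4 : 0 ≤ (c₀ + 8 + c₁ + c₂ * (W + 1) : ℝ) * Δ := by positivity
      have h5 : 0 ≤ (c₂ * (W + 1) : ℝ) := by positivity
      have h6 : (c₀ : ℝ) + 8 + c₁ ≤ c := by rw [hc]; linarith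
      nlinarith
    by_cases hne : F = []
    · obtain ⟨s₁, hd, h11', h14, h15, ha, h0, h1, _⟩ := (henter K F s f h).1 hne
      refine ⟨s₁, (steps_enter h11 h12 hd).mono (by
        have : (0 : ℝ) ≤ c₀ := c₀.cast_nonneg
        linarith), Or.inr ⟨h11', h14, by rw [ha], h0, fun g _ => by rw [ha], by omega, by omega, ?_⟩⟩
      simp [hne]
    · have hpr := hlen hne
      obtain ⟨s₁, hd, hsame, h11', h12', h6⟩ := (henter K F s f h).2.1 hne
        (by rwa [show K + 1 - f = k by omega])
      have hd' := steps_next (Δ := Δ) (by omega) h12' (hpop s₁ (by rw [h11', h6]))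
      refine ⟨_, ((steps_enter h11 h12 hd).trans hd').mono (by linarith), Or.inl ⟨⟨?_, ?_, ?_⟩, ?_⟩⟩
      · exact hsame.trans (by constructor <;> simp)
      · simp [h11']; omega
      · simp [h12']
      · intro S hS
        by_contra hcard
        have := hS.length_le hF.2
        have := Nat.mul_le_mul_left Δ (show S.card ≤ k by omega)
        omega
  induction k with
  | zero => exact fun f F s hf hk hF h h12 => leaf 0 f F s hf hk hF h h12 (by
      intro hF0
      simpa [List.length_pos_iff] using hF0)
  | succ k ih =>
    intro f F s hf hk hF h h12
    by_cases hleaf : F ≠ [] → Δ * (k + 1) < F.length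
    · exact leaf (k + 1) f F s hf hk hF h h12 hleaf
    push Not at hleaf
    obtain ⟨hne, hlen⟩ := hleaf
    have h11 : s.var 11 ≠ 0 := by rw [h.top]; omega
    obtain ⟨s₁, hd, hsame, i, hi, hbr, hsm⟩ := (henter K F s f h).2.2 hne
      (by rwa [show K + 1 - f = k + 1 by omega])
    obtain ⟨s₂, hst, ho⟩ := hbranch K k f (overhead c β k * β ^ k)
      (mul_nonneg (overhead_nonneg hc0 hβ0.le k) (by positivity)) hf hk
      (fun F s hF h h12 => ih (f + 1) F s (by omega) (by omega) hF h h12)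
      W le_rfl F s₁ i hi hF hbr (by simp)
    refine ⟨s₂, ((steps_enter h11 h12 hd).trans hst).mono ?_, ho.of_same hsame⟩
    have h1 := childSum_le hW hβ hβ1 hτ hF.1 (List.getElem_mem hi) hsm
    have hA : 0 ≤ overhead c β k * β ^ k :=
      mul_nonneg (overhead_nonneg hc0 hβ0.le k) (by positivity)
    have h2 := mul_le_mul_of_nonneg_right h1 hA
    have hw := one_le_wt (W := W) hτ1 F
    have hlen' : (F.length : ℝ) + 1 ≤ (Δ + 1) * (k + 2) := by
      have : F.length + 1 ≤ (Δ + 1) * (k + 2) := by nlinarith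
      exact_mod_cast this
    have h3 : (c₁ : ℝ) * (F.length + 1) + 4 + c₂ * (F.length + 1) * (W + 1) ≤ c * (k + 2) := by
      have h4 : (0 : ℝ) ≤ c₁ + c₂ * (W + 1) := by positivity
      have h5 := mul_le_mul_of_nonneg_left hlen' h4
      have h6 : (1 : ℝ) ≤ (Δ + 1) * (k + 2) := le_trans (by simp) hlen'
      have h7 : 0 ≤ ((c₀ : ℝ) + 4) * ((Δ + 1) * (k + 2)) := by positivity
      rw [hc]
      nlinarith
    have h8 : 0 ≤ c * (k + 2) := by positivity
    have h9 := mul_le_mul_of_nonneg_right hw h8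
    rw [overhead_succ_mul hβ0]
    push_cast
    nlinarith

/-! ### Restoring and joining blocks -/

theorem Blk.of_del {W x : ℕ} {a : ℕ → ℕ} {b : ℕ} {F : List (ℕ → ℕ)} (hx : ∀ r ∈ F, ¬ Mem W x r)
    (h : Blk W a b (del x F)) : Blk W a b F := by
  induction F generalizing b with
  | nil => trivial
  | cons r F ih =>
    refine ⟨fun t ht => (h.1 t ht).trans ?_, ih (fun r hr => hx r (List.mem_cons_of_mem _ hr)) h.2⟩
    exact if_neg fun h' => hx r List.mem_cons_self ⟨t, ht, h'⟩

theorem Blk.append {W : ℕ} {a : ℕ → ℕ} {b : ℕ} {F G : List (ℕ → ℕ)} (hF : Blk W a b F)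
    (hG : Blk W a (b + W * F.length) G) : Blk W a b (F ++ G) := by
  induction F generalizing b with
  | nil => simpa using hG
  | cons r F ih =>
    refine ⟨hF.1, ih hF.2 ?_⟩
    convert hG using 1
    rw [List.length_cons]; ring

/-! ### The search for increasing sizes -/

/-- Search for a solution of size at most the value of variable `13`. -/
def sizeStep (W Δ : ℕ) : Prog :=
  .seq (.seq (.assign 6 (.lit 0)) (.seq (.assign 16 (.cell 4 (.lit 1)))
    (.seq (.assign 17 (.var 16)) (.assign 7 (.add (.var 1) (.lit 1))))))
  (.seq (copyDel W)
  (.seq (.seq (.store 4 (.lit 2) (.var 17)) (.seq (.assign 11 (.lit 1)) (.assign 12 (.lit 0))))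
  (.seq (search W Δ) (.assign 13 (.add (.var 13) (.lit 1))))))

/-- Search for solutions of increasing sizes. -/
def sizeLoop (W Δ : ℕ) : Prog := .loop (.sub (.lit 1) (.var 14)) (sizeStep W Δ)

/-- The search for a hitting set of `F` of size `K` can begin. -/
structure Ready (W K : ℕ) (F : List (ℕ → ℕ)) (s : State) : Prop where
  blk : Blk W (s.arr 2) 0 F
  blkEnd : s.arr 4 1 = W * F.length
  fresh : ∀ r ∈ F, ¬ Mem W (s.var 1 + 1) r
  size : s.var 13 = K
  notFound : s.var 14 = 0
  var0 : s.var 0 = 0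
  arr1 : s.arr 1 = fun _ => 0

/-- A smallest hitting set of `F` has been found. -/
structure Minimal (W : ℕ) (F : List (ℕ → ℕ)) (s : State) : Prop where
  var0 : s.var 0 = 0
  arr1 : s.arr 1 = fun _ => 0
  pos : 1 ≤ s.var 15
  le : ∀ S, Hits W F S → s.var 15 ≤ S.card + 1
  hits : ∀ r ∈ F, ∃ g, 1 ≤ g ∧ g < s.var 15 ∧ s.arr 3 g ≠ 0 ∧ Mem W (s.arr 3 g) r

theorem sizeStep_spec {W : ℕ} (hW : 3 ≤ W) (Δ : ℕ) {β : ℝ} (hβ : β ^ 2 = (W - 2) * β + 1)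
    (hβ1 : 1 < β) (hβW : (W : ℝ) - 2 ≤ β) : ∃ c M : ℝ, 0 ≤ c ∧ 0 ≤ M ∧
    ∀ (K : ℕ) (F : List (ℕ → ℕ)) (s : State), Sparse W Δ F → Ready W K F s →
      (∀ S, Hits W F S → K ≤ S.card) →
      ∃ (s' : State) (t : ℕ), Exec (sizeStep W Δ) s s' t ∧
        (t : ℝ) ≤ c * (F.length + 1) + M * β ^ K ∧
        ((Ready W (K + 1) F s' ∧ ∀ S, Hits W F S → K + 1 ≤ S.card) ∨
          (s'.var 14 = 1 ∧ Minimal W F s')) := by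
  have hτ1 : (1 : ℝ) ≤ β - W + 3 := by linarith
  obtain ⟨c₁, hc₁, hsearch⟩ := search_spec hW Δ hβ hβ1 hτ1 rfl
  obtain ⟨c₂, hcopy⟩ := copyDel_spec (show 0 < W by omega)
  obtain ⟨M, hM⟩ := overhead_bounded hc₁ hβ1
  have hβ0 : 0 < β := by linarith
  have hM0 : 0 ≤ M := (overhead_nonneg hc₁ hβ0.le 0).trans (hM 0)
  unfold sizeStep
  set p₀ : Prog := .seq (.assign 6 (.lit 0)) (.seq (.assign 16 (.cell 4 (.lit 1)))
    (.seq (.assign 17 (.var 16)) (.assign 7 (.add (.var 1) (.lit 1))))) with hp₀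
  set p₁ : Prog := .seq (.store 4 (.lit 2) (.var 17))
    (.seq (.assign 11 (.lit 1)) (.assign 12 (.lit 0))) with hp₁
  have hf₀ : p₀.LoopFree := by simp [hp₀, Prog.LoopFree]
  have hf₁ : p₁.LoopFree := by simp [hp₁, Prog.LoopFree]
  -- The root has weight at most `τ = β - W + 3`, and `M` bounds the overhead uniformly in the
  -- budget.
  refine ⟨p₀.bound + c₂ + p₁.bound + 10, (β - W + 3) * M, by positivity, by positivity,
    fun K F s hF h hK => ?_⟩
  have h0 : p₀.run s = (((s.setVar 6 0).setVar 16 (W * F.length)).setVar 17 (W * F.length)).setVar 7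
      (s.var 1 + 1) := by
    simp [hp₀, Prog.run, Expr.eval, h.blkEnd]
  -- The value `s.var 1 + 1` occurs in no row, so `copyDel` is a plain copy here. The search works
  -- on the copy and leaves the rows at address 0 intact for the next budget.
  have hdrop : drop W (s.var 1 + 1) F = F := by
    unfold drop
    exact List.filter_eq_self.2 fun r hr => by simpa using h.fresh r hr
  obtain ⟨s₁, hd, hb, hb', h17, -, hv, ha⟩ := hcopy F (p₀.run s) (by simpa [h0] using h.blk)
    (by simp [h0]) (by simp [h0])
  have e7 : (p₀.run s).var 7 = s.var 1 + 1 := by simp [h0]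
  have e6 : (p₀.run s).var 6 = 0 := by simp [h0]
  have e17 : (p₀.run s).var 17 = W * F.length := by simp [h0]
  have ea : (p₀.run s).arr = s.arr := by simp [h0]
  rw [e6, e7] at hb
  rw [e7, e17, hdrop] at hb' h17
  rw [ea] at ha
  have hb := hb.of_del h.fresh
  have hs₂ : p₁.run s₁ = ((s₁.setCell 4 2 (s₁.var 17)).setVar 11 1).setVar 12 0 := by
    simp [hp₁, Prog.run, Expr.eval]
  have hv' : ∀ v, v ≠ 6 → v ≠ 7 → v ≠ 11 → v ≠ 12 → v ≠ 16 → v ≠ 17 →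
      (p₁.run s₁).var v = s.var v := by
    intro v h6 h7 h11 h12 h16 h17
    simp [hs₂, h11, h12, hv v h6 h17, h0, h6, h7, h16, h17]
  have htop : OnTop W K (p₁.run s₁) 1 F := by
    refine ⟨by simp [hs₂], by simp [hv', h.size], by simp [hv', h.notFound], ?_, ?_⟩
    · simpa [hs₂, ha, h.blkEnd] using hb'
    · simp [hs₂, ha, h.blkEnd, h17]
  obtain ⟨s₃, hst, ho⟩ := hsearch K K 1 F (p₁.run s₁) le_rfl (by omega) hF htop (by simp [hs₂])
  have h11 : s₃.var 11 = 0 := by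
    rcases ho with ⟨h', _⟩ | h'
    · have := h'.top; omega
    · exact h'.top
  obtain ⟨t₃, hx₃, ht₃⟩ := hst s₃ _ (.loop_done (by simpa [Expr.eval] using h11))
  obtain ⟨t₁, ht₁, hx₁⟩ := hd
  obtain ⟨t₀, ht₀, hx₀⟩ := hf₀.does s
  obtain ⟨t₂, ht₂, hx₂⟩ := hf₁.does s₁
  refine ⟨s₃.setVar 13 (s₃.var 13 + 1), _,
    .seq hx₀ (.seq hx₁ (.seq hx₂ (.seq hx₃ (.assign s₃ 13 _)))), ?_, ?_⟩
  · have h1 : wt W (β - W + 3) F * (overhead c₁ β K * β ^ K) ≤ (β - W + 3) * M * β ^ K := by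
      rw [mul_assoc]
      exact mul_le_mul (wt_le hτ1 F)
        (mul_le_mul_of_nonneg_right (hM K) (by positivity))
        (mul_nonneg (overhead_nonneg hc₁ hβ0.le K) (by positivity)) (by linarith)
    have h2 : (t₀ : ℝ) ≤ p₀.bound := by exact_mod_cast ht₀
    have h3 : (t₁ : ℝ) ≤ c₂ * (F.length + 1) := by exact_mod_cast ht₁
    have h4 : (t₂ : ℝ) ≤ p₁.bound := by exact_mod_cast ht₂
    have h5 : 0 ≤ ((p₀.bound : ℝ) + p₁.bound + 10) * F.length := by positivity
    simp only [Expr.cost] at ht₃ ⊢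
    push_cast at ht₃ ⊢
    nlinarith
  · rcases ho with ⟨h', hS⟩ | h'
    · refine Or.inl ⟨⟨?_, ?_, ?_, ?_, ?_, ?_, ?_⟩, hS⟩
      · refine hb.congr fun i _ hi => ?_
        rw [setVar_arr, h'.arr2 i (by simpa [hs₂, ha, h.blkEnd] using hi), hs₂]
        simp
      · simp [h'.arr4, hs₂, ha, h.blkEnd]
      · intro r hr
        simpa [h'.var1, hv'] using h.fresh r hr
      · simp [h'.var13, hv', h.size]
      · simp [h'.var14, hv', h.notFound]
      · simp [h'.var0, hv', h.var0]
      · simp [h'.arr1, hs₂, ha, h.arr1]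
    · refine Or.inr ⟨by simp [h'.found], by simp [h'.var0, hv', h.var0],
        by simp [h'.arr1, hs₂, ha, h.arr1], by simpa using h'.ge, fun S hS => ?_, ?_⟩
      -- At most `K` entries were selected, and by assumption no hitting set has fewer than `K`
      -- elements.
      · have := h'.le
        have := hK S hS
        simp; omega
      · simpa using h'.hits

/-- Induction on the distance `d` to the size of a known hitting set. The costs form a geometric
sum, telescoped through `β ^ K = (β ^ (K + 1) - β ^ K) / (β - 1)`. -/
theorem sizeLoop_spec {W : ℕ} (hW : 3 ≤ W) (Δ : ℕ) {β : ℝ} (hβ : β ^ 2 = (W - 2) * β + 1)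
    (hβ1 : 1 < β) (hβW : (W : ℝ) - 2 ≤ β) : ∃ c M : ℝ, 0 ≤ c ∧ 0 ≤ M ∧
    ∀ (F : List (ℕ → ℕ)), Sparse W Δ F → ∀ (d K : ℕ) (s : State), Ready W K F s →
      (∀ S, Hits W F S → K ≤ S.card) → (∃ S, Hits W F S ∧ S.card = K + d) →
      ∃ (s' : State) (t : ℕ), Exec (sizeLoop W Δ) s s' t ∧
        (t : ℝ) ≤ c * (F.length + 1) * (d + 2) + M * (β ^ (K + d + 1) - β ^ K) ∧
        Minimal W F s' := by
  obtain ⟨c, M, hc, hM, hstep⟩ := sizeStep_spec hW Δ hβ hβ1 hβW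
  have hβ2 : 0 < β - 1 := by linarith
  refine ⟨c + 4, M / (β - 1), by positivity, by positivity, fun F hF d => ?_⟩
  have hl : (0 : ℝ) ≤ F.length := F.length.cast_nonneg
  have hdiv : M / (β - 1) * (β - 1) = M := div_mul_cancel₀ _ hβ2.ne'
  induction d with
  | zero =>
    rintro K s h hK ⟨S, hS, hcard⟩
    obtain ⟨s₁, t₁, hx, ht, ho⟩ := hstep K F s hF h hK
    rcases ho with ⟨_, h'⟩ | ⟨h14, hmin⟩
    · have := h' S hS; omega
    · refine ⟨s₁, _, .loop_step (by simp [Expr.eval, h.notFound]) hx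
        (.loop_done (by simp [Expr.eval, h14])), ?_, hmin⟩
      have : M / (β - 1) * (β ^ (K + 0 + 1) - β ^ K) = M * β ^ K := by
        rw [add_zero, pow_succ, ← hdiv]; field_simp
      rw [this]
      simp only [Expr.cost]
      push_cast
      nlinarith
  | succ d ih =>
    rintro K s h hK ⟨S, hS, hcard⟩
    obtain ⟨s₁, t₁, hx, ht, ho⟩ := hstep K F s hF h hK
    have hpow : M / (β - 1) * (β ^ (K + (d + 1) + 1) - β ^ K) =
        M * β ^ K + M / (β - 1) * (β ^ (K + (d + 1) + 1) - β ^ (K + 1)) := by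
      rw [pow_succ β K, ← hdiv]; field_simp; ring
    rcases ho with ⟨h₁, h'⟩ | ⟨h14, hmin⟩
    · obtain ⟨s₂, t₂, hx₂, ht₂, hmin⟩ := ih (K + 1) s₁ h₁ h' ⟨S, hS, by omega⟩
      refine ⟨s₂, _, .loop_step (by simp [Expr.eval, h.notFound]) hx hx₂, ?_, hmin⟩
      rw [hpow]
      rw [show K + 1 + d + 1 = K + (d + 1) + 1 by ring] at ht₂
      simp only [Expr.cost]
      push_cast
      nlinarith
    · refine ⟨s₁, _, .loop_step (by simp [Expr.eval, h.notFound]) hx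
        (.loop_done (by simp [Expr.eval, h14])), ?_, hmin⟩
      have h1 : β ^ (K + 1) ≤ β ^ (K + (d + 1) + 1) :=
        pow_le_pow_right₀ hβ1.le (by omega)
      have h2 : 0 ≤ M / (β - 1) * (β ^ (K + (d + 1) + 1) - β ^ (K + 1)) :=
        mul_nonneg (by positivity) (by linarith)
      have h3 : 0 ≤ (c + 4) * (F.length + 1) * (d + 1) := by positivity
      rw [hpow]
      simp only [Expr.cost]
      push_cast
      nlinarith

/-! ### Output -/

/-- Mark the selected entries in array `1`. -/
def markLoop : Prog :=
  .loop (.sub (.var 15) (.var 3))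
    (.seq (.store 1 (.sub (.cell 3 (.var 3)) (.lit 1)) (.lit 1))
      (.assign 3 (.add (.var 3) (.lit 1))))

theorem markLoop_spec (d : ℕ) (s : State) (h : s.var 15 = s.var 3 + d) :
    ∃ s', Does markLoop s s' (20 * (d + 1)) ∧
      ∀ j, s'.arr 1 j ≠ 0 ↔
        s.arr 1 j ≠ 0 ∨ ∃ g, s.var 3 ≤ g ∧ g < s.var 15 ∧ j = s.arr 3 g - 1 := by
  induction d generalizing s with
  | zero =>
    refine ⟨s, (Does.loop_done (by simp [Expr.eval, h])).mono (by simp [Expr.cost]), fun j => ?_⟩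
    simp only [iff_self_or]
    rintro ⟨g, h1, h2, _⟩
    omega
  | succ d ih =>
    set body : Prog := .seq (.store 1 (.sub (.cell 3 (.var 3)) (.lit 1)) (.lit 1))
      (.assign 3 (.add (.var 3) (.lit 1))) with hbody
    have hrun : body.run s = (s.setCell 1 (s.arr 3 (s.var 3) - 1) 1).setVar 3 (s.var 3 + 1) := by
      simp [hbody, Prog.run, Expr.eval]
    obtain ⟨s', hd, hj⟩ := ih (body.run s) (by simp [hrun, h]; ring)
    refine ⟨s', (Does.loop_step (by simp [Expr.eval, h])
      ((show body.LoopFree from ⟨trivial, trivial⟩).does s) hd).mono ?_, fun j => ?_⟩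
    · simp only [hbody, Prog.bound, Expr.cost]; omega
    · rw [hj j, hrun]
      simp only [setVar_arr, setVar_var, setCell_arr, if_true, true_and,
        show (15 : ℕ) ≠ 3 by simp, if_false, show (3 : ℕ) ≠ 1 by simp, false_and]
      constructor
      · rintro (h' | ⟨g, h1, h2, h3⟩)
        · split_ifs at h' with h''
          · exact Or.inr ⟨s.var 3, le_rfl, by omega, h''⟩
          · exact Or.inl h'
        · exact Or.inr ⟨g, by omega, h2, h3⟩
      · rintro (h' | ⟨g, h1, h2, h3⟩)
        · left; split_ifs <;> simp [h']
        · rcases h1.eq_or_lt with rfl | h1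
          · left; simp [h3]
          · exact Or.inr ⟨g, h1, h2, h3⟩

/-! ### Input -/

/-- The row with the `d` entries `src 0 + 1`, …, except for the entry number `j`. -/
def rowFn (d : ℕ) (src : ℕ → ℕ) (j : ℕ) : ℕ → ℕ :=
  fun t => if t ≠ j ∧ t < d then src t + 1 else 0

/-- The rows obtained from a list by deleting one of its entries. -/
def rowsOf (l : List ℕ) : List (ℕ → ℕ) :=
  (List.range l.length).map (rowFn l.length fun t => l.getD t 0)

theorem rowFn_congr {d : ℕ} {src src' : ℕ → ℕ} (h : ∀ t < d, src t = src' t) (j : ℕ) :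
    rowFn d src j = rowFn d src' j := by
  funext t
  unfold rowFn
  split_ifs with ht
  · rw [h t ht.2]
  · rfl

/-- Write the `j`-th row of the current check to the address `17`. -/
def writeRow (j n : ℕ) : Prog :=
  unroll n fun t =>
    if t = j then .store 2 (.add (.var 17) (.lit t)) (.lit 0)
    else .cond (.sub (.var 5) (.lit t))
      (.store 2 (.add (.var 17) (.lit t))
        (.add (.cell 0 (.add (.add (.var 3) (.lit 1)) (.lit t))) (.lit 1)))
      (.store 2 (.add (.var 17) (.lit t)) (.lit 0))

theorem writeRow_loopFree (j n : ℕ) : (writeRow j n).LoopFree := by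
  refine unroll_loopFree (fun t => ?_) n
  split_ifs <;> simp [Prog.LoopFree]

theorem writeRow_run (j n : ℕ) (s : State) : ((writeRow j n).run s).var = s.var ∧
    ∀ a i, ((writeRow j n).run s).arr a i =
      if a = 2 ∧ s.var 17 ≤ i ∧ i < s.var 17 + n then
        rowFn (s.var 5) (fun t => s.arr 0 (s.var 3 + 1 + t)) j (i - s.var 17) else s.arr a i := by
  induction n with
  | zero => exact ⟨rfl, fun a i => (if_neg (by omega)).symm⟩
  | succ n ih =>
    obtain ⟨hv, ha⟩ := ih
    have hrun : (writeRow j (n + 1)).run s = ((writeRow j n).run s).setCell 2 (s.var 17 + n)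
        (rowFn (s.var 5) (fun t => s.arr 0 (s.var 3 + 1 + t)) j n) := by
      show Prog.run _ ((writeRow j n).run s) = _
      have h0 : ((writeRow j n).run s).arr 0 = s.arr 0 := by
        funext i; rw [ha, if_neg (by simp)]
      by_cases hj : n = j
      · subst hj
        simp [Prog.run, Expr.eval, rowFn, hv]
      · by_cases h5 : n < s.var 5
        · have : s.var 5 - n ≠ 0 := by omega
          simp [hj, Prog.run, Expr.eval, rowFn, hv, h5, h0, this]
        · have : s.var 5 - n = 0 := by omega
          simp [hj, Prog.run, Expr.eval, rowFn, hv, h5, this]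
    rw [hrun]
    refine ⟨hv, fun a i => ?_⟩
    rw [setCell_arr, ha]
    by_cases hi : a = 2 ∧ i = s.var 17 + n
    · rw [if_pos hi, if_pos ⟨hi.1, by omega, by omega⟩, hi.2]
      congr 1; omega
    · rw [if_neg hi]
      refine if_congr ?_ rfl rfl
      grind

/-- Write the rows of the current check. -/
def writeRows (W : ℕ) : Prog :=
  unroll W fun j =>
    .cond (.sub (.var 5) (.lit j))
      (.seq (writeRow j W) (.assign 17 (.add (.var 17) (.lit W)))) .skip

theorem writeRows_loopFree (W : ℕ) : (writeRows W).LoopFree :=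
  unroll_loopFree (fun j => by exact ⟨⟨writeRow_loopFree j W, trivial⟩, trivial⟩) W

theorem writeRows_run {W : ℕ} (s : State) (hd : s.var 5 ≤ W) :
    Blk W (((writeRows W).run s).arr 2) (s.var 17) ((List.range (s.var 5)).map
        (rowFn (s.var 5) fun t => s.arr 0 (s.var 3 + 1 + t))) ∧
      ((writeRows W).run s).var 17 = s.var 17 + W * s.var 5 ∧
      (∀ i < s.var 17, ((writeRows W).run s).arr 2 i = s.arr 2 i) ∧
      (∀ v, v ≠ 17 → ((writeRows W).run s).var v = s.var v) ∧
      (∀ a, a ≠ 2 → ((writeRows W).run s).arr a = s.arr a) := by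
  set R := rowFn (s.var 5) fun t => s.arr 0 (s.var 3 + 1 + t) with hR
  set P : ℕ → Prog := fun j => .cond (.sub (.var 5) (.lit j))
      (.seq (writeRow j W) (.assign 17 (.add (.var 17) (.lit W)))) .skip with hP
  suffices ∀ n, Blk W (((unroll n P).run s).arr 2) (s.var 17) ((List.range (min n (s.var 5))).map R) ∧
      ((unroll n P).run s).var 17 = s.var 17 + W * min n (s.var 5) ∧
      (∀ i < s.var 17, ((unroll n P).run s).arr 2 i = s.arr 2 i) ∧
      (∀ v, v ≠ 17 → ((unroll n P).run s).var v = s.var v) ∧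
      (∀ a, a ≠ 2 → ((unroll n P).run s).arr a = s.arr a) by
    have := this W
    rw [min_eq_right hd] at this
    exact this
  intro n
  induction n with
  | zero => exact ⟨by simp [Blk], by simp [unroll, Prog.run], fun _ _ => rfl, fun _ _ => rfl,
      fun _ _ => rfl⟩
  | succ n ih =>
    obtain ⟨hb, h17, h2, hv, ha⟩ := ih
    set s₁ := (unroll n P).run s with hs₁
    by_cases hn : n < s.var 5
    · obtain ⟨hv₁, ha₁⟩ := writeRow_run n W s₁
      have hrun : (unroll (n + 1) P).run s =
          ((writeRow n W).run s₁).setVar 17 (s₁.var 17 + W) := by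
        show (P n).run s₁ = _
        have : s.var 5 - n ≠ 0 := by omega
        simp [hP, Prog.run, Expr.eval, hv, this, hv₁]
      have hmin : min (n + 1) (s.var 5) = n + 1 := by omega
      have hmin' : min n (s.var 5) = n := by omega
      rw [hmin'] at hb h17
      rw [hrun, hmin]
      refine ⟨?_, ?_, fun i hi => ?_, fun v hv' => ?_, fun a ha' => ?_⟩
      · rw [List.range_succ, List.map_append, setVar_arr]
        refine (hb.congr fun i _ hi => ?_).append ⟨fun t ht => ?_, trivial⟩
        · rw [ha₁, if_neg]
          simp at hi
          omega
        · simp only [List.length_map, List.length_range]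
          rw [ha₁, if_pos ⟨rfl, by omega, by omega⟩, hv 5 (by simp), hv 3 (by simp), ha 0 (by simp)]
          simp [hR, h17]
      · rw [setVar_var, if_pos rfl, h17]; ring
      · rw [setVar_arr, ha₁, if_neg (by omega), h2 i hi]
      · rw [setVar_var, if_neg hv', hv₁, hv v hv']
      · rw [setVar_arr, ← ha a ha']; funext i; rw [ha₁, if_neg (by tauto)]
    · have hrun : (unroll (n + 1) P).run s = s₁ := by
        show (P n).run s₁ = _
        have : s.var 5 - n = 0 := by omega
        simp [hP, Prog.run, Expr.eval, hv, this]
      have hmin : min (n + 1) (s.var 5) = min n (s.var 5) := by omega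
      rw [hrun, hmin]
      exact ⟨hb, h17, h2, hv, ha⟩

/-- Read one check. -/
def readStep (W : ℕ) : Prog :=
  .seq (.assign 5 (.cell 0 (.var 3)))
  (.cond (.sub (.var 5) (.lit 1))
    (.seq (writeRows W) (.seq (.assign 3 (.add (.var 3) (.add (.var 5) (.lit 1))))
      (.assign 2 (.sub (.var 2) (.lit 1)))))
    (.seq (.assign 4 (.lit 0)) (.assign 2 (.lit 0))))

/-- The time is charged to edges and not to checks, whose number is not bounded in terms of `n` if
some have no neighbours. A check processed in full has degree at least 2, and reading stops at the
first one of smaller degree. -/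
theorem read_spec (W : ℕ) : ∃ c, ∀ (L : List (List ℕ)) (s : State),
    (∀ l ∈ L, l.length ≤ W) → s.var 2 = L.length → s.var 4 = 1 →
    (∀ i, s.arr 0 (s.var 3 + i) = (L.flatMap fun l => l.length :: l).getD i 0) →
    ∃ s', Does (.loop (.var 2) (readStep W)) s s' (c * ((L.map List.length).sum + 2)) ∧
      (((∀ l ∈ L, 2 ≤ l.length) ∧ s'.var 4 = 1 ∧ Blk W (s'.arr 2) (s.var 17) (L.flatMap rowsOf) ∧
        s'.var 17 = s.var 17 + W * (L.flatMap rowsOf).length) ∨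
        ((∃ l ∈ L, l.length < 2) ∧ s'.var 4 = 0)) ∧
      (∀ i < s.var 17, s'.arr 2 i = s.arr 2 i) ∧
      (∀ v, v ≠ 2 → v ≠ 3 → v ≠ 4 → v ≠ 5 → v ≠ 17 → s'.var v = s.var v) ∧
      (∀ a, a ≠ 2 → s'.arr a = s.arr a) := by
  have hfree : (readStep W).LoopFree := by
    simp [readStep, Prog.LoopFree, writeRows_loopFree]
  refine ⟨(Expr.var 2).cost + 1 + (readStep W).bound, fun L => ?_⟩
  induction L with
  | nil =>
    intro s _ h2 h4 _
    refine ⟨s, (Does.loop_done (by simp [Expr.eval, h2])).mono ?_, Or.inl ⟨by simp, h4, trivial, by simp⟩,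
      fun _ _ => rfl, fun _ _ _ _ _ _ => rfl, fun _ _ => rfl⟩
    simp only [List.map_nil, List.sum_nil]; omega
  | cons l L ih =>
    intro s hL h2 h4 h0
    have hlW := hL l List.mem_cons_self
    have hdeg : s.arr 0 (s.var 3) = l.length := by simpa using h0 0
    have hne : (Expr.var 2).eval s ≠ 0 := by simp [Expr.eval, h2]
    obtain ⟨s₀, hs₀⟩ : ∃ s₀, s.setVar 5 l.length = s₀ := ⟨_, rfl⟩
    have e5 : s₀.var 5 = l.length := by simp [← hs₀]
    have ev : ∀ v, v ≠ 5 → s₀.var v = s.var v := fun v hv => by simp [← hs₀, hv]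
    have ea : s₀.arr = s.arr := by simp [← hs₀]
    by_cases hl : 2 ≤ l.length
    · obtain ⟨hb, h17, hc, hv, ha⟩ := writeRows_run (W := W) s₀ (by rwa [e5])
      have hrun : (readStep W).run s = (((writeRows W).run s₀).setVar 3
          (s.var 3 + (l.length + 1))).setVar 2 L.length := by
        have : l.length - 1 ≠ 0 := by omega
        simp [readStep, Prog.run, Expr.eval, hdeg, hs₀, e5, ev, this, hv, h2]
      have hsrc : ∀ i, s.arr 0 (s.var 3 + 1 + i) =
          (l ++ L.flatMap fun l => l.length :: l).getD i 0 := by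
        intro i
        have := h0 (i + 1)
        rw [show s.var 3 + 1 + i = s.var 3 + (i + 1) by ring, this]
        simp [List.flatMap_cons]
      have hrows : (List.range (s₀.var 5)).map
          (rowFn (s₀.var 5) fun t => s₀.arr 0 (s₀.var 3 + 1 + t)) = rowsOf l := by
        rw [e5]
        refine congrArg (fun R => (List.range l.length).map R) (funext fun j => ?_)
        refine rowFn_congr (fun t ht => ?_) j
        rw [ea, ev 3 (by simp), hsrc, List.getD_append _ _ _ _ ht]
      have hlen : (rowsOf l).length = l.length := by simp [rowsOf]
      have h17' : ((readStep W).run s).var 17 = s.var 17 + W * (rowsOf l).length := by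
        simp [hrun, h17, e5, ev, hlen]
      rw [hrows, ev 17 (by simp)] at hb
      obtain ⟨s', hd, ho, h1, h3, h5⟩ := ih ((readStep W).run s)
        (fun l' hl' => hL l' (List.mem_cons_of_mem _ hl')) (by simp [hrun])
        (by simp [hrun, hv, ev, h4]) (by
          intro i
          simp only [hrun, setVar_arr, setVar_var, ha 0 (by simp)]
          simp only [show (3 : ℕ) ≠ 2 by simp, if_false, if_true, ea]
          rw [show s.var 3 + (l.length + 1) + i = s.var 3 + 1 + (l.length + i) by ring, hsrc,
            List.getD_append_right _ _ _ _ (by omega)]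
          congr 1; omega)
      rw [h17'] at ho h1
      refine ⟨s', (Does.loop_step hne (hfree.does s) hd).mono ?_, ?_, ?_, ?_, ?_⟩
      · simp only [List.map_cons, List.sum_cons]
        nlinarith
      · rcases ho with ⟨o1, o2, o3, o4⟩ | ⟨⟨l', hl', hl2⟩, o2⟩
        · refine Or.inl ⟨?_, o2, ?_, ?_⟩
          · simpa using ⟨hl, o1⟩
          · rw [List.flatMap_cons]
            refine (hb.congr fun i _ hi => ?_).append o3
            have hi' : i < s.var 17 + W * (rowsOf l).length := hi
            rw [h1 i hi', hrun]; simp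
          · rw [o4, List.flatMap_cons, List.length_append]; ring
        · exact Or.inr ⟨⟨l', List.mem_cons_of_mem _ hl', hl2⟩, o2⟩
      · intro i hi
        rw [h1 i (by omega), hrun]
        simpa [ea] using hc i (by simpa [ev] using hi)
      · intro v h2 h3' h4 h5' h17
        rw [h3 v h2 h3' h4 h5' h17, hrun]
        simp [h2, h3', hv v h17, ev v h5']
      · intro a ha'
        rw [h5 a ha', hrun]
        simp [ha a ha', ea]
    · have hrun : (readStep W).run s = (s₀.setVar 4 0).setVar 2 0 := by
        have : l.length - 1 = 0 := by omega
        simp [readStep, Prog.run, Expr.eval, hdeg, hs₀, e5, this]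
      refine ⟨(readStep W).run s, (Does.loop_step hne (hfree.does s)
        (Does.loop_done (by simp [hrun, Expr.eval]))).mono ?_, Or.inr ⟨⟨l, by simp, by omega⟩,
          by simp [hrun]⟩, ?_, ?_, ?_⟩
      -- The check that stops the loop may have no edge to charge; its round and the final test
      -- account for the `+ 2` in the bound.
      · have : (Expr.var 2).cost + 1 + (readStep W).bound + ((Expr.var 2).cost + 1) ≤
          ((Expr.var 2).cost + 1 + (readStep W).bound) * 2 := by omega
        refine this.trans (Nat.mul_le_mul_left _ (by omega))
      · intro i _; simp [hrun, ea]
      · intro v h2 h3 h4 h5 h17; simp [hrun, ev v h5, h2, h4]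
      · intro a _; simp [hrun, ea]

/-- The program that solves the minimum cover stopping set problem. -/
def solver (W Δ : ℕ) : Prog :=
  .seq (.seq (.assign 1 (.cell 0 (.lit 0))) (.seq (.assign 2 (.cell 0 (.lit 1)))
    (.seq (.assign 3 (.lit 2)) (.assign 4 (.lit 1)))))
  (.seq (.loop (.var 2) (readStep W))
  (.cond (.var 4)
    (.seq (.store 4 (.lit 1) (.var 17))
    (.seq (sizeLoop W Δ)
    (.seq (.assign 3 (.lit 1))
    (.seq markLoop (.assign 0 (.lit 1)))))) .skip))

theorem solver_spec {W : ℕ} (hW : 3 ≤ W) (Δ : ℕ) {β : ℝ} (hβ : β ^ 2 = (W - 2) * β + 1)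
    (hβ1 : 1 < β) (hβW : (W : ℝ) - 2 ≤ β) : ∃ c M : ℝ, 0 ≤ c ∧ 0 ≤ M ∧
    ∀ (n : ℕ) (L : List (List ℕ)), (∀ l ∈ L, l.length ≤ W) →
      Sparse W Δ (L.flatMap rowsOf) → (∀ r ∈ L.flatMap rowsOf, ¬ Mem W (n + 1) r) →
      ((∃ l ∈ L, l.length < 2) → ∃ (s : State) (t : ℕ),
        Exec (solver W Δ) (initState (n :: L.length :: L.flatMap fun l => l.length :: l)) s t ∧
          s.var 0 = 0 ∧ (t : ℝ) ≤ c * ((L.map List.length).sum + 1)) ∧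
      ((∀ l ∈ L, 2 ≤ l.length) → ∀ k, (∃ S, Hits W (L.flatMap rowsOf) S ∧ S.card = k) →
        (∀ S, Hits W (L.flatMap rowsOf) S → k ≤ S.card) → ∃ (s : State) (t : ℕ),
        Exec (solver W Δ) (initState (n :: L.length :: L.flatMap fun l => l.length :: l)) s t ∧
          s.var 0 = 1 ∧ (t : ℝ) ≤ c * ((L.map List.length).sum + 1) +
            c * ((L.flatMap rowsOf).length + 1) * (k + 2) + M * β ^ k ∧
          ∃ X : Finset ℕ, X.card ≤ k ∧ (∀ j, s.arr 1 j ≠ 0 ↔ j ∈ X) ∧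
            Hits W (L.flatMap rowsOf) (X.image (· + 1))) := by
  obtain ⟨c₁, hread⟩ := read_spec W
  obtain ⟨c₂, M, hc₂, hM, hsize⟩ := sizeLoop_spec hW Δ hβ hβ1 hβW
  unfold solver
  set p₀ : Prog := .seq (.assign 1 (.cell 0 (.lit 0))) (.seq (.assign 2 (.cell 0 (.lit 1)))
    (.seq (.assign 3 (.lit 2)) (.assign 4 (.lit 1)))) with hp₀
  have hf₀ : p₀.LoopFree := by simp [hp₀, Prog.LoopFree]
  have hβ0 : 0 < β := by linarith
  refine ⟨p₀.bound + 2 * c₁ + c₂ + 60, M * β, by positivity, by positivity,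
    fun n L hL hsparse hfresh => ?_⟩
  set s₀ := initState (n :: L.length :: L.flatMap fun l => l.length :: l) with hs₀
  have h0 : p₀.run s₀ = (((s₀.setVar 1 n).setVar 2 L.length).setVar 3 2).setVar 4 1 := by
    simp [hp₀, Prog.run, Expr.eval, hs₀, initState]
  obtain ⟨s₁, ⟨t₁, ht₁, hx₁⟩, ho, -, hv, ha⟩ := hread L (p₀.run s₀) hL (by simp [h0])
    (by simp [h0]) (by
      intro i
      simp only [h0, setVar_arr, setVar_var]
      simp [hs₀, initState, add_comm 2 i])
  obtain ⟨t₀, ht₀, hx₀⟩ := hf₀.does s₀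
  have ht₁' : (t₁ : ℝ) ≤ c₁ * ((L.map List.length).sum + 2) := by exact_mod_cast ht₁
  have ht₀' : (t₀ : ℝ) ≤ p₀.bound := by exact_mod_cast ht₀
  have hc₁ : (0 : ℝ) ≤ c₁ := c₁.cast_nonneg
  have hsum : (0 : ℝ) ≤ ((L.map List.length).sum : ℕ) := Nat.cast_nonneg _
  have hp₀b : (0 : ℝ) ≤ p₀.bound := Nat.cast_nonneg _
  have hv0 : ∀ v, v ≠ 1 → v ≠ 2 → v ≠ 3 → v ≠ 4 → v ≠ 5 → v ≠ 17 → s₁.var v = 0 := by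
    intro v h1 h2 h3 h4 h5 h17
    rw [hv v h2 h3 h4 h5 h17, h0]
    simp [h1, h2, h3, h4, hs₀, initState]
  have hpre : (t₀ : ℝ) + t₁ ≤ (p₀.bound + 2 * c₁) * ((L.map List.length).sum + 1) := by
    nlinarith [mul_nonneg hp₀b hsum, mul_nonneg hc₁ hsum]
  have hcs : 0 ≤ c₂ * ((L.map List.length).sum : ℕ) := mul_nonneg hc₂ hsum
  constructor
  · rintro ⟨l, hl, hl2⟩
    rcases ho with ⟨h, _⟩ | ⟨_, h4⟩
    · exact absurd (h l hl) (by omega)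
    · refine ⟨s₁, _, .seq hx₀ (.seq hx₁ (.cond_false (by simp [Expr.eval, h4]) (.skip s₁))),
        by simp [hv0], ?_⟩
      simp only [Expr.cost, Nat.cast_add, Nat.cast_one]
      nlinarith
  · rintro hge k hex hmin
    rcases ho with ⟨-, h4, hb, h17⟩ | ⟨⟨l, hl, hl2⟩, _⟩
    swap
    · exact absurd (hge l hl) (by omega)
    have e17 : (p₀.run s₀).var 17 = 0 := by rw [h0]; simp [hs₀, initState]
    have ha1 : s₁.arr 1 = fun _ => 0 := by rw [ha 1 (by simp), h0]; simp [hs₀, initState]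
    rw [e17] at hb h17
    -- The budget starts at 0 and is incremented until it reaches the optimum `k`.
    obtain ⟨s₂, t₂, hx₂, ht₂, hm⟩ := hsize _ hsparse k 0 (s₁.setCell 4 1 (s₁.var 17))
      ⟨by simpa using hb, by simp [h17], by simpa [hv, h0] using hfresh, by simp [hv0],
        by simp [hv0], by simp [hv0], by simp [ha1]⟩ (by simp) (by simpa using hex)
    have h15 : s₂.var 15 ≤ k + 1 := by
      obtain ⟨S, hS, rfl⟩ := hex
      exact hm.le S hS
    obtain ⟨s₃, ⟨t₃, ht₃, hx₃⟩, hmark⟩ := markLoop_spec (s₂.var 15 - 1) (s₂.setVar 3 1) (by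
      have := hm.pos
      simp; omega)
    have ht₃' : (t₃ : ℝ) ≤ 20 * (k + 2) := by
      have : t₃ ≤ 20 * (k + 2) := ht₃.trans (by omega)
      exact_mod_cast this
    refine ⟨s₃.setVar 0 1, _, .seq hx₀ (.seq hx₁ (.cond_true (by simp [Expr.eval, h4])
      (.seq (.store s₁ 4 (.lit 1) (.var 17)) (.seq hx₂ (.seq (.assign s₂ 3 (.lit 1))
        (.seq hx₃ (.assign s₃ 0 (.lit 1)))))))), by simp, ?_,
      (Finset.Ico 1 (s₂.var 15)).image fun g => s₂.arr 3 g - 1, ?_, fun j => ?_, fun r hr => ?_⟩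
    · have hF : (0 : ℝ) ≤ ((L.flatMap rowsOf).length : ℕ) := Nat.cast_nonneg _
      have hk : (0 : ℝ) ≤ k := k.cast_nonneg
      have h1 : M * (β ^ (0 + k + 1) - β ^ 0) ≤ M * β * β ^ k := by
        rw [zero_add, pow_succ, pow_zero]; nlinarith
      have h2 : 0 ≤ (p₀.bound + 2 * c₁ : ℝ) *
          (((L.flatMap rowsOf).length + 1) * (k + 2)) := by positivity
      have h3 : 0 ≤ ((L.flatMap rowsOf).length : ℝ) * (k + 2) := by positivity
      simp only [Expr.cost, Nat.cast_add, Nat.cast_one]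
      nlinarith
    · refine Finset.card_image_le.trans ?_
      simp; omega
    · simp only [setVar_arr, hmark, setVar_var]
      simp [hm.arr1, Finset.mem_image, eq_comm, and_assoc]
    · obtain ⟨g, h1, h2, h3, h4⟩ := hm.hits r hr
      refine ⟨_, Finset.mem_image.2 ⟨_, Finset.mem_image.2 ⟨g, by simp [h1, h2], rfl⟩, rfl⟩, ?_⟩
      rw [Nat.sub_add_cancel (by omega)]
      exact ⟨h3, h4⟩

/-! ### Cover stopping sets and hitting sets -/

section

variable {m n : ℕ} (H : Matrix (Fin m) (Fin n) (ZMod 2))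

/-- The neighbours of the check node `r` as a list of natural numbers. -/
def checkVals (r : Fin m) : List ℕ := (checkList H r).map Fin.val

/-- The lists of neighbours of all check nodes. -/
def checks : List (List ℕ) := (List.finRange m).map (checkVals H)

theorem encode_eq :
    encode H = n :: (checks H).length :: (checks H).flatMap fun l => l.length :: l := by
  simp [encode, checks, checkVals, List.flatMap_map]

theorem mem_checkVals {r : Fin m} {j : Fin n} : (j : ℕ) ∈ checkVals H r ↔ j ∈ checkNbrs H r := by
  simp [checkVals, checkList, checkNbrs, Fin.val_inj]

theorem lt_of_mem_checkVals {r : Fin m} {x : ℕ} (h : x ∈ checkVals H r) : x < n := by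
  obtain ⟨j, _, rfl⟩ := List.mem_map.1 h
  exact j.isLt

theorem checkVals_nodup (r : Fin m) : (checkVals H r).Nodup :=
  ((List.nodup_finRange n).filter _).map Fin.val_injective

theorem checkVals_length (r : Fin m) : (checkVals H r).length = (checkNbrs H r).card := by
  have h : (checkList H r).Nodup := (List.nodup_finRange n).filter _
  rw [checkVals, List.length_map, ← List.toFinset_card_of_nodup h]
  congr 1
  ext j
  simp [checkList, checkNbrs]

theorem mem_rowFn {W x j : ℕ} {l : List ℕ} (hl : l.length ≤ W) (hx : x ≠ 0) :
    Mem W x (rowFn l.length (fun t => l.getD t 0) j) ↔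
      ∃ (t : ℕ) (h : t < l.length), t ≠ j ∧ x = l[t] + 1 := by
  constructor
  · rintro ⟨t, ht, h⟩
    unfold rowFn at h
    split_ifs at h with h'
    · exact ⟨t, h'.2, h'.1, by rw [← h]; simp [h'.2]⟩
    · exact absurd h.symm hx
  · rintro ⟨t, ht, htj, rfl⟩
    exact ⟨t, by omega, by simp [rowFn, htj, ht]⟩

/-- Some element `l[t]` lies in `S`, and the row that lacks it forces a second one. A list with a
single element gives an empty row, which nothing hits. -/
theorem hits_rowsOf {W : ℕ} {l : List ℕ} (hl : l.length ≤ W) (hl1 : 1 ≤ l.length) (hnd : l.Nodup)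
    (S : Finset ℕ) :
    Hits W (rowsOf l) (S.image (· + 1)) ↔ ∃ x ∈ l, x ∈ S ∧ ∃ y ∈ l, y ∈ S ∧ x ≠ y := by
  constructor
  · intro h
    have key : ∀ j < l.length, ∃ (t : ℕ) (_ : t < l.length), t ≠ j ∧ l[t] ∈ S := by
      intro j hj
      obtain ⟨x, hx, hx0, hm⟩ := h _ (List.mem_map_of_mem (List.mem_range.2 hj))
      obtain ⟨t, ht, htj, rfl⟩ := (mem_rowFn hl hx0).1 hm
      exact ⟨t, ht, htj, by simpa using hx⟩
    obtain ⟨t, ht, -, htS⟩ := key 0 hl1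
    obtain ⟨u, hu, hut, huS⟩ := key t ht
    exact ⟨_, List.getElem_mem ht, htS, _, List.getElem_mem hu, huS,
      fun h => hut ((hnd.getElem_inj_iff).1 h).symm⟩
  · rintro ⟨x, hx, hxS, y, hy, hyS, hxy⟩ r hr
    obtain ⟨j, hj, rfl⟩ := List.mem_map.1 hr
    obtain ⟨t, ht, rfl⟩ := List.getElem_of_mem hx
    obtain ⟨u, hu, rfl⟩ := List.getElem_of_mem hy
    by_cases htj : t = j
    · refine ⟨_, Finset.mem_image_of_mem _ hyS, by simp, (mem_rowFn hl (by simp)).2 ⟨u, hu, ?_, rfl⟩⟩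
      rintro rfl
      exact hxy (by simp [htj])
    · exact ⟨_, Finset.mem_image_of_mem _ hxS, by simp, (mem_rowFn hl (by simp)).2 ⟨t, ht, htj, rfl⟩⟩

variable {H}

theorem isCoverStoppingSet_iff {S : Finset (Fin n)} :
    IsCoverStoppingSet H S ↔ ∀ r, 2 ≤ (checkNbrs H r ∩ S).card := by
  constructor
  · rintro ⟨h, hc⟩ r
    exact h r (hc ▸ Finset.mem_univ r)
  · refine fun h => ⟨fun r _ => h r, Finset.eq_univ_iff_forall.2 fun r => ?_⟩
    obtain ⟨j, hj⟩ := Finset.card_pos.1 (lt_of_lt_of_le (by simp) (h r))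
    obtain ⟨hj, hjS⟩ := Finset.mem_inter.1 hj
    exact Finset.mem_biUnion.2 ⟨j, hjS, by simpa [varNbrs, checkNbrs] using hj⟩

/-- Values are shifted by one because 0 stands for a deleted entry. A check without neighbours would
give no rows and hence no constraint, so degrees must be positive. -/
theorem hits_iff {W : ℕ} (hW : ∀ r, (checkNbrs H r).card ≤ W) (h1 : ∀ r, 1 ≤ (checkNbrs H r).card)
    {X : Finset ℕ} {S : Finset (Fin n)} (hX : ∀ j : Fin n, (j : ℕ) ∈ X ↔ j ∈ S) :
    Hits W ((checks H).flatMap rowsOf) (X.image (· + 1)) ↔ IsCoverStoppingSet H S := by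
  rw [isCoverStoppingSet_iff]
  have h : Hits W ((checks H).flatMap rowsOf) (X.image (· + 1)) ↔
      ∀ r, Hits W (rowsOf (checkVals H r)) (X.image (· + 1)) := by
    simp only [Hits, checks, List.mem_flatMap, List.mem_map, List.mem_finRange, true_and]
    exact ⟨fun h r x hx => h x ⟨_, ⟨r, rfl⟩, hx⟩, fun h x ⟨_, ⟨r, hr⟩, hx⟩ => h r x (hr ▸ hx)⟩
  rw [h]
  refine forall_congr' fun r => ?_
  rw [hits_rowsOf (by rw [checkVals_length]; exact hW r) (by rw [checkVals_length]; exact h1 r)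
    (checkVals_nodup H r), ← Nat.lt_iff_add_one_le, Finset.one_lt_card]
  constructor
  · rintro ⟨x, hx, hxX, y, hy, hyX, hxy⟩
    obtain ⟨i, rfl⟩ : ∃ i : Fin n, (i : ℕ) = x := ⟨⟨x, lt_of_mem_checkVals H hx⟩, rfl⟩
    obtain ⟨j, rfl⟩ : ∃ j : Fin n, (j : ℕ) = y := ⟨⟨y, lt_of_mem_checkVals H hy⟩, rfl⟩
    exact ⟨i, Finset.mem_inter.2 ⟨(mem_checkVals H).1 hx, (hX i).1 hxX⟩, j,
      Finset.mem_inter.2 ⟨(mem_checkVals H).1 hy, (hX j).1 hyX⟩, fun h => hxy (h ▸ rfl)⟩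
  · rintro ⟨i, hi, j, hj, hij⟩
    obtain ⟨hi, hiS⟩ := Finset.mem_inter.1 hi
    obtain ⟨hj, hjS⟩ := Finset.mem_inter.1 hj
    exact ⟨i, (mem_checkVals H).2 hi, (hX i).2 hiS, j, (mem_checkVals H).2 hj, (hX j).2 hjS,
      fun h => hij (Fin.ext h)⟩

theorem le_of_mem_row {W x : ℕ} (hW : ∀ r, (checkNbrs H r).card ≤ W) {r : ℕ → ℕ}
    (hr : r ∈ (checks H).flatMap rowsOf) (hx : x ≠ 0) (hm : Mem W x r) : x ≤ n := by
  obtain ⟨l, hl, hr⟩ := List.mem_flatMap.1 hr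
  obtain ⟨q, -, rfl⟩ := List.mem_map.1 hl
  obtain ⟨j, -, rfl⟩ := List.mem_map.1 hr
  obtain ⟨t, ht, -, h⟩ := (mem_rowFn (by rw [checkVals_length]; exact hW q) hx).1 hm
  have := lt_of_mem_checkVals H (List.getElem_mem ht)
  omega

/-- Nonzero entries of rows lie between 1 and `n`, so the other elements of `T` can be discarded. -/
theorem exists_isCoverStoppingSet {W : ℕ} (hW : ∀ r, (checkNbrs H r).card ≤ W)
    (h1 : ∀ r, 1 ≤ (checkNbrs H r).card) {T : Finset ℕ}
    (hT : Hits W ((checks H).flatMap rowsOf) T) :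
    ∃ S, IsCoverStoppingSet H S ∧ S.card ≤ T.card := by
  classical
  set S : Finset (Fin n) := Finset.univ.filter fun j => (j : ℕ) + 1 ∈ T with hS
  refine ⟨S, (hits_iff hW h1 (X := S.image Fin.val) (S := S) fun j => ?_).1 fun r hr => ?_, ?_⟩
  · simp [Fin.val_inj]
  · obtain ⟨x, hxT, hx0, hm⟩ := hT r hr
    have hxn := le_of_mem_row hW hr hx0 hm
    refine ⟨x, Finset.mem_image.2 ⟨x - 1, Finset.mem_image.2 ⟨⟨x - 1, by omega⟩, ?_, rfl⟩,
      by omega⟩, hx0, hm⟩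
    simpa [hS, Nat.sub_add_cancel (Nat.one_le_iff_ne_zero.2 hx0)] using hxT
  · refine Finset.card_le_card_of_injOn (fun j => (j : ℕ) + 1) (fun j hj => ?_) fun i _ j _ h => ?_
    · simpa [hS] using hj
    · exact Fin.ext (by simpa using h)

theorem sum_length_checks : ((checks H).map List.length).sum = ∑ r, (checkNbrs H r).card := by
  rw [checks, List.map_map, ← List.ofFn_eq_map, List.sum_ofFn]
  exact Finset.sum_congr rfl fun r _ => checkVals_length H r

theorem sum_card_checkNbrs (H : Matrix (Fin m) (Fin n) (ZMod 2)) :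
    ∑ r, (checkNbrs H r).card = ∑ j, (varNbrs H j).card := by
  simp only [checkNbrs, varNbrs, Finset.card_filter]
  exact Finset.sum_comm

/-- Row `j` of a check lacks its entry `j`. A value belongs to at most `δv` checks, each of which
gives at most `W` rows. -/
theorem sparse_flatMap_rowsOf {δv W : ℕ} (h : IsLDPC δv W H) :
    Sparse W (δv * W) ((checks H).flatMap rowsOf) := by
  classical
  have hW : ∀ r, (checkVals H r).length ≤ W := fun r => by rw [checkVals_length]; exact h.2 r
  refine ⟨fun r hr => ?_, fun x hx => ?_⟩
  · obtain ⟨l, hl, hr⟩ := List.mem_flatMap.1 hr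
    obtain ⟨q, -, rfl⟩ := List.mem_map.1 hl
    obtain ⟨j, hj, rfl⟩ := List.mem_map.1 hr
    exact cnt_pos.2 ⟨j, (List.mem_range.1 hj).trans_le (hW q), by simp [rowFn]⟩
  · have key : ∀ q, occ W x (rowsOf (checkVals H q)) ≤ if x - 1 ∈ checkVals H q then W else 0 := by
      intro q
      split_ifs with hq
      · exact List.countP_le_length.trans (by simpa [rowsOf] using hW q)
      · refine (List.countP_eq_zero.2 fun r hr => ?_).le
        obtain ⟨j, -, rfl⟩ := List.mem_map.1 hr
        simp only [decide_eq_true_eq]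
        intro hm
        obtain ⟨t, ht, -, rfl⟩ := (mem_rowFn (hW q) hx).1 hm
        exact hq (by simp)
    have hocc : occ W x ((checks H).flatMap rowsOf) =
        ∑ q, occ W x (rowsOf (checkVals H q)) := by
      rw [occ, List.countP_flatMap, checks, List.map_map, ← List.ofFn_eq_map, List.sum_ofFn]
      rfl
    rw [hocc]
    refine (Finset.sum_le_sum fun q _ => key q).trans ?_
    rw [← Finset.sum_filter, Finset.sum_const, smul_eq_mul]
    refine Nat.mul_le_mul_right W ?_
    by_cases hxn : x - 1 < n
    · refine le_trans (Finset.card_le_card fun q hq => ?_) (h.1 ⟨x - 1, hxn⟩)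
      have := (mem_checkVals H (j := ⟨x - 1, hxn⟩)).1 (Finset.mem_filter.1 hq).2
      simpa [varNbrs, checkNbrs] using this
    · rw [Finset.card_eq_zero.2 (Finset.filter_eq_empty_iff.2 fun q _ hq =>
        hxn (lt_of_mem_checkVals H hq))]
      exact Nat.zero_le _

theorem sum_card_checkNbrs_le {δv W : ℕ} (h : IsLDPC δv W H) :
    ∑ r, (checkNbrs H r).card ≤ δv * n := by
  rw [sum_card_checkNbrs]
  refine (Finset.sum_le_sum fun j _ => h.1 j).trans ?_
  simp [mul_comm]

end

/-! ### The running time in terms of `κ` and `n` -/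

theorem solver_solves (δv : ℕ) {W : ℕ} (hW : 3 ≤ W) {β : ℝ} (hβ : β ^ 2 = (W - 2) * β + 1)
    (hβ1 : 1 < β) (hβW : (W : ℝ) - 2 ≤ β) : ∃ C : ℝ, 0 ≤ C ∧
    SolvesMinCStop δv W (solver W (δv * W)) fun {_ n} H =>
      C * (β ^ coverStoppingSize H + n) := by
  obtain ⟨c, M, hc, hM, hsolve⟩ := solver_spec hW (δv * W) hβ hβ1 hβW
  -- Copying a number of rows linear in `κ` for each of the `κ + 1` budgets is quadratic in `κ`; `B`
  -- absorbs this into `β ^ κ`.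
  obtain ⟨B, hB⟩ := (tendsto_pow_const_div_const_pow_of_one_lt 2 hβ1).bddAbove_range
  have hB' : ∀ k : ℕ, (k : ℝ) ^ 2 ≤ B * β ^ k := fun k =>
    (div_le_iff₀ (by positivity)).1 (hB ⟨k, rfl⟩)
  have hB0 : 0 ≤ B := by simpa using hB' 0
  set A : ℝ := (δv * W : ℕ) + 1 with hA
  have hA1 : 1 ≤ A := by rw [hA]; linarith [Nat.cast_nonneg (α := ℝ) (δv * W)]
  refine ⟨c * (δv + 1) + c * A * (2 * B + 8) + M, by positivity, fun m n H hH => ?_⟩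
  have hδ : (0 : ℝ) ≤ δv := δv.cast_nonneg
  have hn : (0 : ℝ) ≤ n := n.cast_nonneg
  have hpow : 1 ≤ β ^ coverStoppingSize H := one_le_pow₀ hβ1.le
  have hL : ∀ l ∈ checks H, l.length ≤ W := by
    intro l hl
    obtain ⟨r, -, rfl⟩ := List.mem_map.1 hl
    rw [checkVals_length]
    exact hH.2 r
  have hsum : (((checks H).map List.length).sum : ℝ) ≤ δv * n := by
    have := sum_card_checkNbrs_le hH
    rw [← sum_length_checks] at this
    exact_mod_cast this
  have hsum' : c * ((((checks H).map List.length).sum : ℕ) + 1) ≤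
      c * (δv + 1) * (β ^ coverStoppingSize H + n) := by
    rw [mul_assoc]
    refine mul_le_mul_of_nonneg_left ?_ hc
    nlinarith
  obtain ⟨hno, hyes⟩ := hsolve n (checks H) hL (sparse_flatMap_rowsOf hH)
    fun r hr hm => absurd (le_of_mem_row hH.2 hr (by simp) hm) (by simp)
  rw [encode_eq]
  by_cases hdeg : ∀ r, 2 ≤ (checkNbrs H r).card
  · have h1 : ∀ r, 1 ≤ (checkNbrs H r).card := fun r => le_trans (by simp) (hdeg r)
    -- This makes the set under the infimum nonempty, so `κ` is attained and is not the default
    -- value 0.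
    have hex : IsCoverStoppingSet H Finset.univ :=
      isCoverStoppingSet_iff.2 fun r => by simpa using hdeg r
    have hmem : ∃ S, IsCoverStoppingSet H S ∧ S.card = coverStoppingSize H :=
      Nat.sInf_mem (s := {k | ∃ S, IsCoverStoppingSet H S ∧ S.card = k}) ⟨_, _, hex, rfl⟩
    have hmin : ∀ S, IsCoverStoppingSet H S → coverStoppingSize H ≤ S.card :=
      fun S hS => Nat.sInf_le ⟨S, hS, rfl⟩
    have hhit : ∃ T, Hits W ((checks H).flatMap rowsOf) T ∧ T.card = coverStoppingSize H := by
      obtain ⟨S, hS, hcard⟩ := hmem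
      refine ⟨_, (hits_iff hH.2 h1 (X := S.image Fin.val) fun j => by simp [Fin.val_inj]).2 hS, ?_⟩
      rw [Finset.card_image_of_injective _ (add_left_injective 1),
        Finset.card_image_of_injective _ Fin.val_injective, hcard]
    obtain ⟨s, t, hx, h0, ht, X, hXc, hX, hXh⟩ := hyes (by
        intro l hl
        obtain ⟨r, -, rfl⟩ := List.mem_map.1 hl
        rw [checkVals_length]
        exact hdeg r) _ hhit fun T hT => by
      obtain ⟨S, hS, hle⟩ := exists_isCoverStoppingSet hH.2 h1 hT
      exact (hmin S hS).trans hle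
    have hout : (outputSet n s).card ≤ X.card :=
      Finset.card_le_card_of_injOn Fin.val
        (fun j hj => (hX j).1 (by simpa [outputSet] using hj)) Fin.val_injective.injOn
    refine ⟨s, t, hx, Or.inl ⟨h0, (hits_iff hH.2 h1 fun j => ?_).1 hXh,
      fun S hS => hout.trans (hXc.trans (hmin S hS))⟩, ht.trans ?_⟩
    · rw [← hX]; simp [outputSet]
    · have hlen : (((checks H).flatMap rowsOf).length : ℝ) + 1 ≤ A * (coverStoppingSize H + 1) := by
        obtain ⟨T, hT, hcard⟩ := hhit
        have := hT.length_le (sparse_flatMap_rowsOf hH).2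
        rw [hcard] at this
        have h' : (((checks H).flatMap rowsOf).length : ℝ) ≤
            (δv * W : ℕ) * (coverStoppingSize H : ℝ) := by exact_mod_cast this
        have hκ : (0 : ℝ) ≤ coverStoppingSize H := Nat.cast_nonneg _
        rw [hA]
        linarith
      have hκ : (0 : ℝ) ≤ coverStoppingSize H := Nat.cast_nonneg _
      set κ : ℝ := (coverStoppingSize H : ℝ) with hκdef
      have hsq : (κ + 1) * (κ + 2) ≤ (2 * B + 8) * β ^ coverStoppingSize H := by
        have := hB' (coverStoppingSize H)
        nlinarith [sq_nonneg (κ - 2)]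
      have h2 : c * ((((checks H).flatMap rowsOf).length : ℝ) + 1) * (κ + 2) ≤
          c * A * (2 * B + 8) * β ^ coverStoppingSize H := by
        calc c * ((((checks H).flatMap rowsOf).length : ℝ) + 1) * (κ + 2)
            ≤ c * (A * (κ + 1)) * (κ + 2) := by gcongr
          _ = c * A * ((κ + 1) * (κ + 2)) := by ring
          _ ≤ c * A * ((2 * B + 8) * β ^ coverStoppingSize H) := by gcongr
          _ = _ := by ring
      have h3 : 0 ≤ (c * A * (2 * B + 8) + M) * n := by positivity
      linarith
  -- Without a solution only input is read, and `1 ≤ β ^ κ` covers the additive constant.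
  · push Not at hdeg
    obtain ⟨r, hr⟩ := hdeg
    obtain ⟨s, t, hx, h0, ht⟩ := hno ⟨checkVals H r, List.mem_map_of_mem (List.mem_finRange r),
      by rwa [checkVals_length]⟩
    refine ⟨s, t, hx, Or.inr ⟨h0, ?_⟩, ht.trans (hsum'.trans ?_)⟩
    · rintro ⟨S, hS⟩
      have := isCoverStoppingSet_iff.1 hS r
      exact absurd (this.trans (Finset.card_le_card Finset.inter_subset_left)) (by omega)
    · have : 0 ≤ (c * A * (2 * B + 8) + M) * (β ^ coverStoppingSize H + n) := by positivity
      linarith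

theorem computable_mul_pow (a b : ℕ) : Computable fun k : ℕ => a * b ^ k := by
  have h : Primrec fun k : ℕ => a * b ^ k := by
    have h' : Primrec fun k : ℕ => Nat.rec (motive := fun _ => ℕ) a (fun _ v => v * b) k :=
      Primrec.nat_rec₁ a (Primrec.nat_mul.comp Primrec.snd (Primrec.const b)).to₂
    refine h'.of_eq fun k => ?_
    induction k with
    | zero => simp
    | succ k ih => simp only [ih, pow_succ]; ring
  exact h.to_comp

end Tanner

theorem mainTheorem12 (δv δc : ℕ) (hδv : 2 < δv) (hδc : 2 < δc) :
    Tanner.MinCStopIsFPT δv δc ∧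
    ∃ (P : Tanner.Prog) (C : ℝ),
      Tanner.SolvesMinCStop δv δc P (fun {_ n} H =>
        C * ((((δc : ℝ) - 2) / 2 * (1 + √(1 + 4 / ((δc : ℝ) - 2) ^ 2)))
              ^ Tanner.coverStoppingSize H + (n : ℝ))) := by
  set β : ℝ := ((δc : ℝ) - 2) / 2 * (1 + √(1 + 4 / ((δc : ℝ) - 2) ^ 2)) with hβdef
  have ha : (1 : ℝ) ≤ (δc : ℝ) - 2 := by
    have : (3 : ℝ) ≤ δc := by exact_mod_cast hδc
    linarith
  have hβ : β ^ 2 = ((δc : ℝ) - 2) * β + 1 := by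
    have hr := Real.sq_sqrt (show 0 ≤ 1 + 4 / ((δc : ℝ) - 2) ^ 2 by positivity)
    have h4 : ((δc : ℝ) - 2) ^ 2 * (4 / ((δc : ℝ) - 2) ^ 2) = 4 := by
      field_simp
    rw [hβdef]
    linear_combination (((δc : ℝ) - 2) ^ 2 / 4) * hr + h4 / 4
  have hβa : (δc : ℝ) - 2 < β := by
    have hr : 1 < √(1 + 4 / ((δc : ℝ) - 2) ^ 2) := by
      rw [Real.lt_sqrt (by norm_num)]
      have : 0 < 4 / ((δc : ℝ) - 2) ^ 2 := by positivity
      linarith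
    rw [hβdef]
    nlinarith
  have hβ1 : 1 < β := by linarith
  -- Otherwise `β * (β - (δc - 2))` would exceed 1. The integer power `δc ^ k` then gives an
  -- evidently computable `f`, with exponent 1 for the size.
  have hβδ : β ≤ δc := by nlinarith
  obtain ⟨C, hC, hsolve⟩ := Tanner.solver_solves δv (show 3 ≤ δc from hδc) hβ hβ1 hβa.le
  refine ⟨⟨Tanner.solver δc (δv * δc), fun k => ⌈C⌉₊ * δc ^ k, 1,
    Tanner.computable_mul_pow _ _, fun m n H hH => ?_⟩, _, C, hsolve⟩
  obtain ⟨s, t, hx, hs, ht⟩ := hsolve m n H hH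
  refine ⟨s, t, hx, hs, ht.trans ?_⟩
  have hn : (n : ℝ) ≤ Tanner.tannerSize H := by
    exact_mod_cast (show n ≤ Tanner.tannerSize H by unfold Tanner.tannerSize; omega)
  have hpow : β ^ Tanner.coverStoppingSize H ≤ (δc : ℝ) ^ Tanner.coverStoppingSize H :=
    pow_le_pow_left₀ (by linarith) hβδ _
  have h1 : (1 : ℝ) ≤ (δc : ℝ) ^ Tanner.coverStoppingSize H := one_le_pow₀ (by linarith)
  have hN : (0 : ℝ) ≤ Tanner.tannerSize H := Nat.cast_nonneg _
  push_cast
  rw [pow_one, mul_assoc]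
  refine mul_le_mul (Nat.le_ceil C) ?_ (by positivity) (by positivity)
  nlinarith
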